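/- Let $P,q\in\mathbb C(z)$ be rational functions, $n=\deg P\ge 1$ and $q\not\equiv 0$, and let $\gamma\subset\mathbb C$ be a closed oriented piecewise-smooth curve passing through no pole of $P$ or of $q$. For $z\in\mathbb{CP}^1\setminus\gamma$ let $\mu(\gamma,z)$ be the winding number of $\gamma$ about $z$ (with $\mu(\gamma,\infty)=0$). Let $U_\infty$ be the connected component of $\mathbb{CP}^1\setminus P(\gamma)$ containing $\infty$, and let $$I_\infty(t)=\frac1{2\pi i}\int_\gamma\frac{q(z)\,dz}{P(z)-t},\qquad t\in U_\infty$$ (so $I_\infty(\infty)=0$). Let $U\subset\mathbb C$ be a simply connected domain that contains no branch point of the algebraic function $P^{-1}$ and has $\infty$ in its boundary in $\mathbb{CP}^1$, and let $P_1^{-1},\dots,P_n^{-1}:U\to\mathbb{CP}^1$ be the single-valued branches of $P^{-1}$ on $U$. Let $z^q_1,\dots,z^q_l$ be the finite poles of $q$, let $q_s$ be the principal part of the Laurent series of $q$ at $z^q_s$, and put $$\psi_s(t)=\sum_{i=1}^n\Big(\frac{q_s}{P'}\Big)(P_i^{-1}(t)).$$ Let $z^P_1,\dots,z^P_r$ be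 the poles of $P$ in $\mathbb{CP}^1$, and let $J_e$ be the set of those $i$ for which $P_i^{-1}(t)\to z^P_e$ as $t\to\infty$ in $U$. 1. Each $\psi_s$ is a rational function: it coincides with one at every $t\in U$ at which all its summands are finite. 2. If $U\cap\{|t|>R\}$ is connected for arbitrarily large $R$, then every index $i\in\{1,\dots,n\}$ belongs to exactly one of $J_1,\dots,J_r$. 3. If every $i\in\{1,\dots,n\}$ belongs to one of $J_1,\dots,J_r$ (that is, each branch $P_i^{-1}(t)$ has a limit as $t\to\infty$ in $U$), then for all $t\in U\cap U_\infty$ close enough to infinity all the terms below are finite and $$I_\infty(t)=\sum_{e=1}^r\mu(\gamma,z^P_e)\sum_{i\in J_e}\Big(\frac q{P'}\Big)(P_i^{-1}(t))-\sum_{s=1}^l\mu(\gamma,z^q_s)\,\psi_s(t)+\frac1{2\pi i}\,\frac1{P(\infty)-t}\int_\gamma q(z)\,dz,$$ where $1/(P(\infty)-t)=0$ if $P(\infty)=\infty$. 4. If the poles of $P$ lie on one side of $\gamma$, i.e. $\mu(\gamma,z^P_1)=\dots=\mu(\gamma,z^P_r)$, then $I_\infty$ is a rational function (it coincides on $U_\infty$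 with one that has no poles there). 5. If the poles of $P$ and of $q$ all lie outside $\gamma$, i.e. $\mu(\gamma,\cdot)=0$ at each of them, then $I_\infty\equiv 0$ on $U_\infty$. -/

import Mathlib

open scoped OnePoint LaurentSeries Topology
open Filter Set MeasureTheory

namespace MomentGen

/-! ### Rational functions on the Riemann sphere `OnePoint ℂ` -/

/-- The value in `OnePoint ℂ = ℂ ∪ {∞}` of a rational function at a point of the sphere.
`R.num / R.denom` is in lowest terms; at `∞` one compares the coefficients of
degree `N = max (deg num) (deg denom)`. -/
noncomputable def sphereVal (R : RatFunc ℂ) (x : OnePoint ℂ) : OnePoint ℂ :=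
  open Classical in
  x.elim
    (if R.denom.coeff (max R.num.natDegree R.denom.natDegree) = 0 then ∞
      else ((R.num.coeff (max R.num.natDegree R.denom.natDegree) /
        R.denom.coeff (max R.num.natDegree R.denom.natDegree) : ℂ) : OnePoint ℂ))
    (fun z => if R.denom.eval z = 0 then ∞
      else ((R.num.eval z / R.denom.eval z : ℂ) : OnePoint ℂ))

/-- The complex number underlying a finite point of the sphere (and `0` for `∞`). -/
noncomputable def toC (x : OnePoint ℂ) : ℂ := x.elim 0 id

/-- The degree of a rational function as a self-map of the sphere. -/
noncomputable def degree (R : RatFunc ℂ) : ℕ := max R.num.natDegree R.denom.natDegree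

/-- The derivative of a rational function, by the quotient rule. -/
noncomputable def ratDeriv (R : RatFunc ℂ) : RatFunc ℂ :=
  algebraMap (Polynomial ℂ) (RatFunc ℂ)
      (Polynomial.derivative R.num * R.denom - R.num * Polynomial.derivative R.denom) /
    algebraMap (Polynomial ℂ) (RatFunc ℂ) (R.denom ^ 2)

/-- The poles of `R` on the sphere. -/
def poles (R : RatFunc ℂ) : Set (OnePoint ℂ) := {x | sphereVal R x = ∞}

theorem poles_finite (R : RatFunc ℂ) : (poles R).Finite := by
  classical
  refine ((R.denom.roots.toFinset.finite_toSet.image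
    (fun z : ℂ => (z : OnePoint ℂ))).insert ∞).subset ?_
  intro x hx
  induction x using OnePoint.rec with
  | infty => exact mem_insert _ _
  | coe z =>
    refine mem_insert_of_mem _ ⟨z, ?_, rfl⟩
    by_contra h
    have h0 : R.denom.eval z ≠ 0 := fun h0 => h (by simp [R.denom_ne_zero, h0])
    simp only [poles, sphereVal, mem_ofPred_eq, OnePoint.elim_some, if_neg h0] at hx
    exact OnePoint.coe_ne_infty _ hx

/-- The poles of `R` on the sphere, as a finite set. -/
noncomputable def polesFinset (R : RatFunc ℂ) : Finset (OnePoint ℂ) := (poles_finite R).toFinset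

open Classical in
/-- The finite poles of `R`. -/
noncomputable def finitePoles (R : RatFunc ℂ) : Finset ℂ := R.denom.roots.toFinset

/-- The principal part `∑_{k ≥ 1} a_{-k} (z - z₀)^{-k}` of the Laurent series of `R` at `z₀`.
`RatFunc.laurent z₀ R` is `R(z + z₀)`, which is then expanded as a Laurent series at `0`;
the coefficients `a_{-k}` vanish for `k` larger than the order of the pole. -/
noncomputable def principalPart (R : RatFunc ℂ) (z₀ : ℂ) : RatFunc ℂ :=
  ∑ k ∈ Finset.Icc 1 (R.denom.rootMultiplicity z₀),
    RatFunc.C (HahnSeries.coeff (RatFunc.laurent z₀ R : ℂ⸨X⸩) (-(k : ℤ))) *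
      ((RatFunc.X - RatFunc.C z₀) ^ k)⁻¹

/-- The branch points on the sphere of the inverse `P⁻¹` of `P`: the values of `P` at the points
near which `P` is not injective. -/
def branchPoints (P : RatFunc ℂ) : Set (OnePoint ℂ) :=
  {c | ∃ x, sphereVal P x = c ∧ ∀ V ∈ 𝓝 x, ¬ InjOn (sphereVal P) V}

/-- `g₁, …, gₙ`, `n = deg P`, are the `n` single-valued branches of `P⁻¹` on `U`, with values in the
sphere: they are continuous, they are right inverses of `P`, and they are distinct, so
that `g₁ t, …, gₙ t` are the `n` preimages of `t`. (When `U` contains no branch point, such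
branches are holomorphic.) -/
structure IsBranches (P : RatFunc ℂ) (U : Set ℂ) (g : Fin (degree P) → ℂ → OnePoint ℂ) : Prop where
  continuousOn : ∀ i, ContinuousOn (g i) U
  rightInv : ∀ i, ∀ t ∈ U, sphereVal P (g i t) = (t : OnePoint ℂ)
  injective : ∀ t ∈ U, Function.Injective (fun i => g i t)

open Classical in
/-- `J_e`: the indices of the branches that tend to `e` when `t` tends to infinity in `U`. -/
noncomputable def branchesNear {n : ℕ} (U : Set ℂ) (g : Fin n → ℂ → OnePoint ℂ) (e : OnePoint ℂ) :
    Finset (Fin n) :=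
  {i | Tendsto (g i) (Bornology.cobounded ℂ ⊓ 𝓟 U) (𝓝 e)}

/-- The sum `∑_i (q / P')(P_i⁻¹(t))` over the branches with index in `J`. -/
noncomputable def branchSum {n : ℕ} (P q : RatFunc ℂ) (g : Fin n → ℂ → OnePoint ℂ)
    (J : Finset (Fin n)) (t : ℂ) : ℂ :=
  ∑ i ∈ J, toC (sphereVal (q / ratDeriv P) (g i t))

/-- `ψ_z(t) = ∑_{i = 1}^n (q_z / P')(P_i⁻¹(t))`, with `q_z` the principal part of `q` at `z`. -/
noncomputable def psi {n : ℕ} (P q : RatFunc ℂ) (g : Fin n → ℂ → OnePoint ℂ) (z t : ℂ) : ℂ :=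
  branchSum P (principalPart q z) g Finset.univ t

/-! ### Curves -/

/-- `γ` restricted to `[0, 1]` is a closed piecewise continuously differentiable curve. -/
structure IsClosedCurve (γ : ℝ → ℂ) : Prop where
  continuousOn : ContinuousOn γ (Icc 0 1)
  piecewise : ∃ (m : ℕ) (x : ℕ → ℝ), Monotone x ∧ x 0 = 0 ∧ x m = 1 ∧
    ∀ k < m, ContDiffOn ℝ 1 γ (Icc (x k) (x (k + 1)))
  closed : γ 0 = γ 1

/-- `∫_γ f(z) dz`. -/
noncomputable def curveInt (γ : ℝ → ℂ) (f : ℂ → ℂ) : ℂ := ∫ s in (0 : ℝ)..1, f (γ s) * deriv γ s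

/-- The value of a rational function at a finite point that is not a pole. -/
noncomputable def val (R : RatFunc ℂ) (z : ℂ) : ℂ := RatFunc.eval (RingHom.id ℂ) z R

/-- The winding number of a closed curve in `ℂ` about a point of the sphere off the curve; about `∞`
it is `0`. -/
noncomputable def winding (γ : ℝ → ℂ) (x : OnePoint ℂ) : ℂ :=
  x.elim 0 (fun w => (2 * Real.pi * Complex.I)⁻¹ * curveInt γ (fun z => (z - w)⁻¹))

/-- The component `U_∞` of the complement of `P(γ)` in the sphere that contains `∞`. -/
def UInf (P : RatFunc ℂ) (γ : ℝ → ℂ) : Set (OnePoint ℂ) :=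
  connectedComponentIn ((fun s => sphereVal P (γ s : OnePoint ℂ)) '' Icc (0 : ℝ) 1)ᶜ ∞

/-- The function `(2πi)⁻¹ ∫_γ q(z) dz / (P(z) - t)` of a point `t` of the sphere off `P(γ)` (it is
`0` at `t = ∞`); on `UInf P γ` it is the function `I_∞`. -/
noncomputable def IFun (q P : RatFunc ℂ) (γ : ℝ → ℂ) (x : OnePoint ℂ) : ℂ :=
  x.elim 0 (fun t => (2 * Real.pi * Complex.I)⁻¹ * curveInt γ (fun z => val q z / (val P z - t)))

/-- `1 / (P(∞) - t)`, which is `0` when `P(∞) = ∞`. -/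
noncomputable def recipAtInfty (P : RatFunc ℂ) (t : ℂ) : ℂ :=
  (sphereVal P ∞).elim 0 (fun c => (c - t)⁻¹)

/-- The points of `S` lie on one side of the closed curve `γ`: its winding numbers about
them are equal. -/
def OnOneSide (γ : ℝ → ℂ) (S : Set (OnePoint ℂ)) : Prop :=
  ∀ x ∈ S, ∀ y ∈ S, winding γ x = winding γ y

/-- The points of `S` lie outside `γ`: its winding numbers about them are all `0`. -/
def LieOutside (γ : ℝ → ℂ) (S : Set (OnePoint ℂ)) : Prop :=
  ∀ x ∈ S, winding γ x = 0

end MomentGen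

/-! Write `P = N/D` in lowest terms and `F_t = N - tD` (`fiberPoly`). All but finitely many `t` are
generic: `F_t` has degree `n = deg P` and simple roots (`eventually_isGenericValue`). For such `t`,
`1/(P - t) = D/F_t` has simple poles exactly at the fibre, with residues `1/P'(w)`, and tends to
`1/(P(∞) - t)` at infinity. Its partial fraction expansion is `IsGenericValue.inv_val_sub`, obtained
by Lagrange interpolation of `D` at the fibre (`denom_eq`). Multiplying by `q` and integrating
leaves one Cauchy integral of `q` for each fibre point `w`. Partial fractions of `q` evaluate it as
`μ(w) q(w) - ∑ μ(a) q_a(w)` over the poles `a` of `q` (`IsClosedCurve.cauchy_val`). The result,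
`IsClosedCurve.IFun_eq`, is exact for every generic `t` off `P(γ)` whose fibre avoids the poles of
`q`.

As `t → ∞` the fibre moves into any given neighbourhood of the poles of `P`, where `μ` is locally
constant. Replacing `μ(w)` by the winding number about the limiting pole and grouping branches by
their limits gives the formula with the sets `J_e`. A limit exists when `U` has connected tails:
compactness puts the image of a tail into a union of disjoint neighbourhoods of the poles, and
connectedness selects one of them.

If all poles of `P` have the same winding number, only sums `∑ r(w)/P'(w)` over whole fibres remain.
They are rational in `t` for an elementary reason: a linear functional applied to `denom_eq`
evaluates `∑ φ(F_t/(X - w))/P'(w)` in closed form. Taking for `φ` the Taylor coefficients at a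
point, or the coefficients read from the top, gives a triangular recursion for the sums with `r = (z
- a)^{-k}` or `r = z^k` (`isRat_fiber_pow_inv`, `isRat_fiber_pow`). The identity theorem carries an
equality near `∞` to all of `U_∞` (`IsClosedCurve.eq_IFun_of_eventually_eq`). When the poles of `P`
and `q` all have winding number `0`, every term of the formula vanishes. -/

namespace MomentGen

open scoped Polynomial

section

/-! ### Evaluation of rational functions -/

/-- `R` has no pole at `z`. -/
def Reg (R : RatFunc ℂ) (z : ℂ) : Prop := R.denom.eval z ≠ 0

theorem val_def (R : RatFunc ℂ) (z : ℂ) : val R z = R.num.eval z / R.denom.eval z := rfl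

theorem num_ne_zero_of_denom_eval_eq_zero {R : RatFunc ℂ} {z : ℂ} (h : R.denom.eval z = 0) :
    R.num.eval z ≠ 0 := by
  obtain ⟨a, b, hab⟩ := R.isCoprime_num_denom
  intro h'
  have := congrArg (Polynomial.eval z) hab
  simp [h, h'] at this

/-- The reduced denominator divides `r`, so the fraction need not be in lowest terms. -/
theorem reg_div_of_eval_ne_zero (p : ℂ[X]) {r : ℂ[X]} {z : ℂ} (h : r.eval z ≠ 0) :
    Reg (algebraMap ℂ[X] (RatFunc ℂ) p / algebraMap ℂ[X] (RatFunc ℂ) r) z := by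
  intro h0
  obtain ⟨c, hc⟩ := RatFunc.denom_div_dvd p r
  exact h (by rw [hc, Polynomial.eval_mul, h0, zero_mul])

theorem val_div_of_eval_ne_zero (p : ℂ[X]) {r : ℂ[X]} {z : ℂ} (h : r.eval z ≠ 0) :
    val (algebraMap ℂ[X] (RatFunc ℂ) p / algebraMap ℂ[X] (RatFunc ℂ) r) z
      = p.eval z / r.eval z := by
  have hr : r ≠ 0 := by rintro rfl; simp at h
  have h1 := (RatFunc.num_mul_eq_mul_denom_iff hr).2
    (rfl : algebraMap ℂ[X] (RatFunc ℂ) p / algebraMap ℂ[X] (RatFunc ℂ) r = _)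
  have h2 := congrArg (Polynomial.eval z) h1
  simp only [Polynomial.eval_mul] at h2
  rw [val_def, div_eq_div_iff (reg_div_of_eval_ne_zero p h) h, h2]

theorem eq_num_div_denom (R : RatFunc ℂ) :
    R = algebraMap ℂ[X] (RatFunc ℂ) R.num / algebraMap ℂ[X] (RatFunc ℂ) R.denom :=
  R.num_div_denom.symm

theorem algebraMap_ne_zero' {p : ℂ[X]} (h : p ≠ 0) : algebraMap ℂ[X] (RatFunc ℂ) p ≠ 0 :=
  RatFunc.algebraMap_ne_zero h

theorem reg_add {R S : RatFunc ℂ} {z : ℂ} (hR : Reg R z) (hS : Reg S z) : Reg (R + S) z := by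
  intro h0
  obtain ⟨c, hc⟩ := RatFunc.denom_add_dvd R S
  have := congrArg (Polynomial.eval z) hc
  simp only [Polynomial.eval_mul, h0, zero_mul, mul_eq_zero] at this
  exact this.elim hR hS

theorem reg_mul {R S : RatFunc ℂ} {z : ℂ} (hR : Reg R z) (hS : Reg S z) : Reg (R * S) z := by
  intro h0
  obtain ⟨c, hc⟩ := RatFunc.denom_mul_dvd R S
  have := congrArg (Polynomial.eval z) hc
  simp only [Polynomial.eval_mul, h0, zero_mul, mul_eq_zero] at this
  exact this.elim hR hS

theorem val_add {R S : RatFunc ℂ} {z : ℂ} (hR : Reg R z) (hS : Reg S z) :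
    val (R + S) z = val R z + val S z := RatFunc.eval_add _ _ hR hS

theorem val_mul {R S : RatFunc ℂ} {z : ℂ} (hR : Reg R z) (hS : Reg S z) :
    val (R * S) z = val R z * val S z := RatFunc.eval_mul _ _ hR hS

theorem reg_algebraMap (p : ℂ[X]) (z : ℂ) : Reg (algebraMap ℂ[X] (RatFunc ℂ) p) z := by
  simp [Reg]

theorem val_algebraMap (p : ℂ[X]) (z : ℂ) : val (algebraMap ℂ[X] (RatFunc ℂ) p) z = p.eval z := by
  simp [val_def]

theorem reg_C (c z : ℂ) : Reg (RatFunc.C c) z := by simp [Reg]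

theorem val_C (c z : ℂ) : val (RatFunc.C c) z = c := by simp [val_def]

theorem reg_inv {R : RatFunc ℂ} {z : ℂ} (h : val R z ≠ 0) : Reg R⁻¹ z := by
  rw [eq_num_div_denom R, inv_div]
  refine reg_div_of_eval_ne_zero _ fun h0 => h ?_
  rw [val_def, h0, zero_div]

theorem val_inv {R : RatFunc ℂ} {z : ℂ} (h : val R z ≠ 0) :
    val R⁻¹ z = (val R z)⁻¹ := by
  have h0 : R.num.eval z ≠ 0 := fun h0 => h (by rw [val_def, h0, zero_div])
  conv_lhs => rw [eq_num_div_denom R, inv_div]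
  rw [val_div_of_eval_ne_zero _ h0, val_def, inv_div]

theorem reg_div {R S : RatFunc ℂ} {z : ℂ} (hR : Reg R z) (h : val S z ≠ 0) :
    Reg (R / S) z := by
  rw [div_eq_mul_inv]; exact reg_mul hR (reg_inv h)

theorem val_div {R S : RatFunc ℂ} {z : ℂ} (hR : Reg R z) (h : val S z ≠ 0) :
    val (R / S) z = val R z / val S z := by
  rw [div_eq_mul_inv, val_mul hR (reg_inv h), val_inv h, div_eq_mul_inv]

theorem reg_sub {R S : RatFunc ℂ} {z : ℂ} (hR : Reg R z) (hS : Reg S z) : Reg (R - S) z := by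
  have : R - S = R + RatFunc.C (-1) * S := by simp [sub_eq_add_neg]
  rw [this]; exact reg_add hR (reg_mul (reg_C _ _) hS)

theorem reg_sum {ι : Type*} (s : Finset ι) (R : ι → RatFunc ℂ) {z : ℂ}
    (h : ∀ i ∈ s, Reg (R i) z) : Reg (∑ i ∈ s, R i) z := by
  classical
  induction s using Finset.induction_on with
  | empty => simp [Reg]
  | insert a s ha ih =>
    rw [Finset.sum_insert ha]
    exact reg_add (h a (by simp)) (ih fun i hi => h i (by simp [hi]))

theorem val_sum {ι : Type*} (s : Finset ι) (R : ι → RatFunc ℂ) {z : ℂ}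
    (h : ∀ i ∈ s, Reg (R i) z) : val (∑ i ∈ s, R i) z = ∑ i ∈ s, val (R i) z := by
  classical
  induction s using Finset.induction_on with
  | empty => simp [val_def]
  | insert a s ha ih =>
    have hs : ∀ i ∈ s, Reg (R i) z := fun i hi => h i (by simp [hi])
    rw [Finset.sum_insert ha, Finset.sum_insert ha,
      val_add (h a (by simp)) (reg_sum s R hs), ih hs]

theorem reg_eventually (R : RatFunc ℂ) : ∀ᶠ z in cofinite, Reg R z := by
  have : {z | ¬ Reg R z} ⊆ R.denom.rootSet ℂ := by
    intro z hz
    simp only [Reg, not_not, mem_ofPred_eq] at hz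
    simpa [Polynomial.mem_rootSet, R.denom_ne_zero] using hz
  exact (R.denom.rootSet_finite ℂ).subset this

theorem reg_iff_notMem_finitePoles {R : RatFunc ℂ} {z : ℂ} : Reg R z ↔ z ∉ finitePoles R := by
  simp [Reg, finitePoles, R.denom_ne_zero]

theorem continuousAt_val {R : RatFunc ℂ} {z : ℂ} (h : Reg R z) : ContinuousAt (val R) z :=
  R.num.continuous.continuousAt.div R.denom.continuous.continuousAt h

theorem differentiableAt_val {R : RatFunc ℂ} {z : ℂ} (h : Reg R z) :
    DifferentiableAt ℂ (val R) z :=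
  R.num.differentiable.differentiableAt.div R.denom.differentiable.differentiableAt h

theorem isOpen_reg (R : RatFunc ℂ) : IsOpen {z | Reg R z} :=
  isOpen_ne_fun R.denom.continuous continuous_const

theorem analyticAt_val {R : RatFunc ℂ} {z : ℂ} (h : Reg R z) : AnalyticAt ℂ (val R) z := by
  rw [Complex.analyticAt_iff_eventually_differentiableAt]
  filter_upwards [(isOpen_reg R).mem_nhds h] with w hw using differentiableAt_val hw

/-! ### The map of the sphere given by a rational function -/

open Classical in
/-- The point `a / b` of the sphere. -/
noncomputable def sphereQuot (a b : ℂ) : OnePoint ℂ :=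
  if b = 0 then ∞ else ((a / b : ℂ) : OnePoint ℂ)

theorem sphereVal_coe (R : RatFunc ℂ) (z : ℂ) :
    sphereVal R z = sphereQuot (R.num.eval z) (R.denom.eval z) := by
  simp [sphereVal, sphereQuot]

theorem sphereVal_infty (R : RatFunc ℂ) :
    sphereVal R ∞ = sphereQuot (R.num.coeff (degree R)) (R.denom.coeff (degree R)) := by
  simp only [sphereVal, sphereQuot, degree]; rfl

theorem sphereVal_of_reg {R : RatFunc ℂ} {z : ℂ} (h : Reg R z) :
    sphereVal R z = (val R z : OnePoint ℂ) := by
  rw [sphereVal_coe, sphereQuot, if_neg h]; rfl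

theorem sphereVal_of_not_reg {R : RatFunc ℂ} {z : ℂ} (h : ¬ Reg R z) : sphereVal R z = ∞ := by
  rw [sphereVal_coe, sphereQuot, if_pos (not_not.1 h)]

theorem reg_iff {R : RatFunc ℂ} {z : ℂ} : Reg R z ↔ sphereVal R z ≠ ∞ := by
  refine ⟨fun h => ?_, fun h => not_imp_comm.1 sphereVal_of_not_reg h⟩
  rw [sphereVal_of_reg h]; exact OnePoint.coe_ne_infty _

theorem tendsto_nhds_infty_iff {α : Type*} {l : Filter α} {f : α → OnePoint ℂ} :
    Tendsto f l (𝓝 ∞) ↔ ∀ r : ℝ, ∀ᶠ a in l, ∀ z : ℂ, f a = z → r < ‖z‖ := by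
  rw [OnePoint.hasBasis_nhds_infty.tendsto_right_iff]
  constructor
  · intro h r
    have := h (Metric.closedBall 0 r) ⟨Metric.isClosed_closedBall, isCompact_closedBall 0 r⟩
    filter_upwards [this] with a ha z hz
    rw [hz] at ha
    simpa using ha
  · rintro h s ⟨-, hs⟩
    obtain ⟨r, hr⟩ := hs.isBounded.subset_closedBall 0
    filter_upwards [h r] with a ha
    induction hfa : f a using OnePoint.rec with
    | infty => simp
    | coe z =>
      refine Or.inl ⟨z, fun hz => ?_, rfl⟩
      have := hr hz
      have h2 := ha z hfa
      simp only [Metric.mem_closedBall, dist_zero_right] at this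
      linarith

/-- This is the projection of `ℂ² ∖ 0` onto the projective line. Continuity of `sphereVal` at poles
and at `∞` reduces to it, because numerator and denominator never vanish together. -/
theorem continuousAt_sphereQuot {p : ℂ × ℂ} (hp : p ≠ 0) :
    ContinuousAt (fun p : ℂ × ℂ => sphereQuot p.1 p.2) p := by
  obtain ⟨a, b⟩ := p
  by_cases hb : b = 0
  · subst hb
    have ha : a ≠ 0 := by rintro rfl; exact hp rfl
    have hab : sphereQuot a 0 = ∞ := by simp [sphereQuot]
    unfold ContinuousAt
    simp only [hab]
    rw [tendsto_nhds_infty_iff]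
    intro r
    have : ∀ᶠ x : ℂ × ℂ in 𝓝 (a, 0), r * ‖x.2‖ < ‖x.1‖ := by
      refine ContinuousAt.eventually_lt (by fun_prop) (by fun_prop) ?_
      simpa using ha
    filter_upwards [this] with x hx z hz
    by_cases hx2 : x.2 = 0
    · simp [sphereQuot, hx2] at hz
    · rw [sphereQuot, if_neg hx2] at hz
      rw [← OnePoint.coe_injective hz, norm_div, lt_div_iff₀ (norm_pos_iff.2 hx2)]
      exact hx
  · have : (fun p : ℂ × ℂ => sphereQuot p.1 p.2) =ᶠ[𝓝 (a, b)]
        fun p => ((p.1 / p.2 : ℂ) : OnePoint ℂ) := by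
      have : ∀ᶠ p : ℂ × ℂ in 𝓝 (a, b), p.2 ≠ 0 :=
        continuousAt_snd.eventually_ne hb
      filter_upwards [this] with p h
      rw [sphereQuot, if_neg h]
    refine ContinuousAt.congr ?_ this.symm
    exact OnePoint.continuous_coe.continuousAt.comp (continuousAt_fst.div continuousAt_snd hb)

theorem sphereQuot_mul (a b : ℂ) {c : ℂ} (hc : c ≠ 0) :
    sphereQuot (a * c) (b * c) = sphereQuot a b := by
  simp only [sphereQuot, mul_eq_zero, hc, or_false]
  split_ifs with h
  · rfl
  · rw [mul_div_mul_right _ _ hc]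

theorem natDegree_num_le (R : RatFunc ℂ) : R.num.natDegree ≤ degree R := le_max_left _ _
theorem natDegree_denom_le (R : RatFunc ℂ) : R.denom.natDegree ≤ degree R := le_max_right _ _

theorem eval_reflect_inv {p : ℂ[X]} {n : ℕ} (h : p.natDegree ≤ n) {z : ℂ} (hz : z ≠ 0) :
    (p.reflect n).eval z⁻¹ * z ^ n = p.eval z := by
  let := invertibleOfNonzero hz
  have := Polynomial.eval₂_reflect_mul_pow (RingHom.id ℂ) z n p h
  simpa using this

theorem leadingCoeff_num_or_denom (R : RatFunc ℂ) :
    (R.num.coeff (degree R), R.denom.coeff (degree R)) ≠ (0 : ℂ × ℂ) := by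
  intro h
  rw [Prod.mk_eq_zero] at h
  rcases le_total R.num.natDegree R.denom.natDegree with hle | hle
  · rw [degree, max_eq_right hle] at h
    exact R.denom_ne_zero (Polynomial.leadingCoeff_eq_zero.1 h.2)
  · rw [degree, max_eq_left hle] at h
    have hn := Polynomial.leadingCoeff_eq_zero.1 h.1
    rw [hn, Polynomial.natDegree_zero, Nat.le_zero] at hle
    rw [hn, Polynomial.natDegree_zero, ← hle] at h
    exact R.denom_ne_zero (Polynomial.leadingCoeff_eq_zero.1 h.2)

theorem continuous_sphereVal (R : RatFunc ℂ) : Continuous (sphereVal R) := by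
  rw [continuous_iff_continuousAt]
  intro x
  induction x using OnePoint.rec with
  | infty =>
    have hr0 : ∀ p : ℂ[X], (p.reflect (degree R)).eval 0 = p.coeff (degree R) := fun p => by
      rw [← Polynomial.coeff_zero_eq_eval_zero, Polynomial.coeff_reflect, Polynomial.revAt_le
        (Nat.zero_le _), Nat.sub_zero]
    rw [OnePoint.continuousAt_infty', sphereVal_infty, coclosedCompact_eq_cocompact,
      ← Metric.cobounded_eq_cocompact]
    -- In the coordinate `w = 1/z` the map is the quotient of the reflected polynomials; their
    -- values at `0` are the coefficients of degree `degree R`.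
    have h1 : ContinuousAt (fun w : ℂ => sphereQuot ((R.num.reflect (degree R)).eval w)
        ((R.denom.reflect (degree R)).eval w)) 0 := by
      refine ContinuousAt.comp (f := fun w : ℂ => ((R.num.reflect (degree R)).eval w,
        (R.denom.reflect (degree R)).eval w)) (continuousAt_sphereQuot ?_) (by fun_prop)
      rw [hr0, hr0]
      exact leadingCoeff_num_or_denom R
    have h2 := h1.tendsto.comp (tendsto_inv₀_cobounded (α := ℂ))
    simp only [hr0] at h2
    refine h2.congr' ?_
    have : ∀ᶠ z : ℂ in Bornology.cobounded ℂ, z ≠ 0 := Bornology.eventually_ne_cobounded 0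
    filter_upwards [this] with z hz
    simp only [Function.comp_apply]
    rw [sphereVal_coe, ← eval_reflect_inv (natDegree_num_le R) hz,
      ← eval_reflect_inv (natDegree_denom_le R) hz, sphereQuot_mul _ _ (pow_ne_zero _ hz)]
  | coe z =>
    rw [OnePoint.continuousAt_coe]
    have : sphereVal R ∘ ((↑) : ℂ → OnePoint ℂ) =
        fun z => sphereQuot (R.num.eval z) (R.denom.eval z) := funext fun z => sphereVal_coe R z
    rw [this]
    refine ContinuousAt.comp (f := fun w : ℂ => (R.num.eval w, R.denom.eval w))
      (continuousAt_sphereQuot ?_) (by fun_prop)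
    intro h
    rw [Prod.mk_eq_zero] at h
    exact num_ne_zero_of_denom_eval_eq_zero h.2 h.1

end

section

/-! ### Integrals along closed curves -/

theorem exists_mem_Ico_of_partition {m : ℕ} {x : ℕ → ℝ} {t : ℝ} (h0 : x 0 ≤ t) (h1 : t < x m) :
    ∃ k < m, t ∈ Ico (x k) (x (k + 1)) := by
  induction m with
  | zero => exact absurd h1 (not_lt.2 h0)
  | succ m ih =>
    rcases lt_or_ge t (x m) with h | h
    · obtain ⟨k, hk, hkt⟩ := ih h
      exact ⟨k, hk.trans (Nat.lt_succ_self m), hkt⟩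
    · exact ⟨m, Nat.lt_succ_self m, h, h1⟩

theorem IsClosedCurve.exists_finite_hasDerivAt {γ : ℝ → ℂ} (hγ : IsClosedCurve γ) :
    ∃ S : Set ℝ, S.Finite ∧ ∀ t ∈ Ioo (0 : ℝ) 1 \ S, HasDerivAt γ (deriv γ t) t := by
  obtain ⟨m, x, -, h0, h1, hx⟩ := hγ.piecewise
  refine ⟨x '' Iic m, (finite_Iic m).image x, fun t ht => ?_⟩
  obtain ⟨k, hk, hkt⟩ := exists_mem_Ico_of_partition (m := m) (x := x) (t := t)
    (by rw [h0]; exact ht.1.1.le) (by rw [h1]; exact ht.1.2)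
  have hne : x k ≠ t := fun h => ht.2 ⟨k, hk.le, h⟩
  have hn : Icc (x k) (x (k + 1)) ∈ 𝓝 t := Icc_mem_nhds (lt_of_le_of_ne hkt.1 hne) hkt.2
  exact (((hx k hk).contDiffAt hn).differentiableAt one_ne_zero).hasDerivAt

/-- On each piece `deriv γ` agrees, away from the endpoints, with the one-sided derivative, which is
continuous on the closed piece. -/
theorem IsClosedCurve.intervalIntegrable_deriv {γ : ℝ → ℂ} (hγ : IsClosedCurve γ) :
    IntervalIntegrable (deriv γ) volume 0 1 := by
  obtain ⟨m, x, hmono, h0, h1, hx⟩ := hγ.piecewise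
  rw [← h0, ← h1]
  refine IntervalIntegrable.trans_iterate fun k hk => ?_
  -- The partition is only monotone, so a piece may be a single point.
  rcases (hmono (Nat.le_succ k)).eq_or_lt with h | h
  · rw [Nat.succ_eq_add_one] at h; rw [h]
  · have hc := (hx k hk).continuousOn_derivWithin (uniqueDiffOn_Icc h) le_rfl
    rw [Nat.succ_eq_add_one] at h
    have hi : IntervalIntegrable (derivWithin γ (Icc (x k) (x (k + 1)))) volume (x k) (x (k + 1)) :=
      (by rwa [uIcc_of_le h.le] : ContinuousOn _ (uIcc (x k) (x (k + 1)))).intervalIntegrable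
    refine hi.congr_ae ?_
    rw [uIoc_of_le h.le, ← restrict_Ioo_eq_restrict_Ioc]
    filter_upwards [self_mem_ae_restrict measurableSet_Ioo] with t ht
    exact derivWithin_of_mem_nhds (Icc_mem_nhds ht.1 ht.2)

variable {γ : ℝ → ℂ} {f g : ℂ → ℂ}

theorem IsClosedCurve.isCompact_trace (hγ : IsClosedCurve γ) : IsCompact (γ '' Icc 0 1) :=
  isCompact_Icc.image_of_continuousOn hγ.continuousOn

theorem IsClosedCurve.intervalIntegrable (hγ : IsClosedCurve γ)
    (hf : ContinuousOn f (γ '' Icc 0 1)) :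
    IntervalIntegrable (fun s => f (γ s) * deriv γ s) volume 0 1 := by
  refine hγ.intervalIntegrable_deriv.continuousOn_mul ?_
  rw [uIcc_of_le zero_le_one]
  exact hf.comp hγ.continuousOn (mapsTo_image _ _)

theorem curveInt_congr (h : EqOn f g (γ '' Icc 0 1)) : curveInt γ f = curveInt γ g := by
  refine intervalIntegral.integral_congr fun s hs => ?_
  rw [uIcc_of_le zero_le_one] at hs
  simp only [h (mem_image_of_mem γ hs)]

theorem IsClosedCurve.curveInt_add (hγ : IsClosedCurve γ) (hf : ContinuousOn f (γ '' Icc 0 1))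
    (hg : ContinuousOn g (γ '' Icc 0 1)) :
    curveInt γ (fun z => f z + g z) = curveInt γ f + curveInt γ g := by
  simp only [curveInt, add_mul]
  exact intervalIntegral.integral_add (hγ.intervalIntegrable hf) (hγ.intervalIntegrable hg)

theorem IsClosedCurve.curveInt_sub (hγ : IsClosedCurve γ) (hf : ContinuousOn f (γ '' Icc 0 1))
    (hg : ContinuousOn g (γ '' Icc 0 1)) :
    curveInt γ (fun z => f z - g z) = curveInt γ f - curveInt γ g := by
  simp only [curveInt, sub_mul]
  exact intervalIntegral.integral_sub (hγ.intervalIntegrable hf) (hγ.intervalIntegrable hg)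

theorem curveInt_const_mul (γ : ℝ → ℂ) (c : ℂ) (f : ℂ → ℂ) :
    curveInt γ (fun z => c * f z) = c * curveInt γ f := by
  simp only [curveInt, mul_assoc]
  exact intervalIntegral.integral_const_mul _ _

theorem IsClosedCurve.curveInt_sum (hγ : IsClosedCurve γ) {ι : Type*} (s : Finset ι)
    {F : ι → ℂ → ℂ} (hF : ∀ i ∈ s, ContinuousOn (F i) (γ '' Icc 0 1)) :
    curveInt γ (fun z => ∑ i ∈ s, F i z) = ∑ i ∈ s, curveInt γ (F i) := by
  simp only [curveInt, Finset.sum_mul]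
  exact intervalIntegral.integral_finsetSum fun i hi => hγ.intervalIntegrable (hF i hi)

/-- The fundamental theorem of calculus with the breakpoints as exceptional set. The primitive is
needed only at points of the trace, so a branch of the logarithm adapted to the curve is allowed. -/
theorem IsClosedCurve.curveInt_eq_zero (hγ : IsClosedCurve γ) {F : ℂ → ℂ}
    (hf : ContinuousOn f (γ '' Icc 0 1)) (hF : ∀ z ∈ γ '' Icc 0 1, HasDerivAt F (f z) z) :
    curveInt γ f = 0 := by
  obtain ⟨S, hS, hd⟩ := hγ.exists_finite_hasDerivAt
  have := MeasureTheory.integral_eq_of_hasDerivAt_off_countable (fun s => F (γ s))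
    (fun s => f (γ s) * deriv γ s) (a := 0) (b := 1) hS.countable ?_ ?_ (hγ.intervalIntegrable hf)
  · rw [curveInt, this, hγ.closed, sub_self]
  · rw [uIcc_of_le zero_le_one]
    exact ContinuousOn.comp (t := γ '' Icc 0 1)
      (fun z hz => (hF z hz).continuousAt.continuousWithinAt) hγ.continuousOn (mapsTo_image _ _)
  · intro s hs
    rw [min_eq_left zero_le_one, max_eq_right zero_le_one] at hs
    exact (hF _ (mem_image_of_mem γ (Ioo_subset_Icc_self hs.1))).comp s (hd s hs)

theorem continuousOn_inv_sub {w : ℂ} {K : Set ℂ} (hw : w ∉ K) :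
    ContinuousOn (fun z => (z - w)⁻¹) K :=
  (continuousOn_id.sub continuousOn_const).inv₀ fun z hz h => hw (by
    rwa [← sub_eq_zero.1 (show z - w = 0 from h)])

theorem continuousOn_pow_inv_sub {w : ℂ} {K : Set ℂ} (hw : w ∉ K) (k : ℕ) :
    ContinuousOn (fun z => ((z - w) ^ k)⁻¹) K := by
  simp only [← inv_pow]; exact (continuousOn_inv_sub hw).pow k

theorem IsClosedCurve.curveInt_polynomial (hγ : IsClosedCurve γ) (p : ℂ[X]) :
    curveInt γ (fun z => p.eval z) = 0 := by
  have hp : (fun z => p.eval z) = fun z => ∑ i ∈ p.support, p.coeff i * z ^ i := by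
    funext z; rw [Polynomial.eval_eq_sum, Polynomial.sum_def]
  rw [hp, hγ.curveInt_sum _ fun i _ => by fun_prop]
  refine Finset.sum_eq_zero fun i _ => ?_
  rw [curveInt_const_mul]
  refine mul_eq_zero_of_right _ (hγ.curveInt_eq_zero
    (F := fun z => z ^ (i + 1) / ((i + 1 : ℕ) : ℂ)) (by fun_prop) fun z _ => ?_)
  have := (hasDerivAt_pow (i + 1) z).div_const ((i + 1 : ℕ) : ℂ)
  rwa [mul_div_cancel_left₀ _ (Nat.cast_ne_zero.2 (Nat.succ_ne_zero i)), Nat.add_sub_cancel]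
    at this

theorem IsClosedCurve.curveInt_pow_inv (hγ : IsClosedCurve γ) {w : ℂ} (hw : w ∉ γ '' Icc 0 1)
    (k : ℕ) : curveInt γ (fun z => ((z - w) ^ (k + 2))⁻¹) = 0 := by
  refine hγ.curveInt_eq_zero (F := fun z => -((k + 1 : ℕ) : ℂ)⁻¹ * ((z - w) ^ (k + 1))⁻¹)
    (continuousOn_pow_inv_sub hw _) fun z hz => ?_
  have hzw : z - w ≠ 0 := fun h => hw (by rwa [← sub_eq_zero.1 h])
  have h1 : HasDerivAt (fun z => (z - w) ^ (k + 1)) (((k + 1 : ℕ) : ℂ) * (z - w) ^ k * 1) z := by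
    have := (hasDerivAt_pow (k + 1) (z - w)).comp z ((hasDerivAt_id z).sub_const w)
    rw [Nat.add_sub_cancel] at this
    exact this
  have := (h1.inv (pow_ne_zero _ hzw)).const_mul (-((k + 1 : ℕ) : ℂ)⁻¹)
  convert! this using 1
  have hk : ((k + 1 : ℕ) : ℂ) ≠ 0 := Nat.cast_ne_zero.2 (Nat.succ_ne_zero k)
  field_simp
  ring

/-! ### Winding numbers -/

theorem winding_coe (γ : ℝ → ℂ) (w : ℂ) :
    winding γ w = (2 * Real.pi * Complex.I)⁻¹ * curveInt γ (fun z => (z - w)⁻¹) := rfl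

theorem one_add_mem_slitPlane {z : ℂ} (h : ‖z‖ < 1) : 1 + z ∈ Complex.slitPlane := by
  left
  have := (abs_lt.1 ((Complex.abs_re_le_norm z).trans_lt h)).1
  simp only [Complex.add_re, Complex.one_re]
  linarith

/-- The difference of the integrands is the derivative of `log ((z - w)/(z - w₀))`. When `w` is
closer to `w₀` than the trace is, this ratio stays within distance less than `1` of `1`, so the
principal branch serves along the whole curve. Integrality of the winding number plays no role. -/
theorem IsClosedCurve.winding_eventually_eq (hγ : IsClosedCurve γ) {w₀ : ℂ}
    (hw₀ : w₀ ∉ γ '' Icc 0 1) : ∀ᶠ w : ℂ in 𝓝 w₀, winding γ (w : OnePoint ℂ) = winding γ w₀ := by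
  obtain ⟨r, hr, hball⟩ := Metric.isOpen_iff.1 hγ.isCompact_trace.isClosed.isOpen_compl w₀ hw₀
  filter_upwards [Metric.ball_mem_nhds w₀ hr] with w hw
  have hw' : w ∉ γ '' Icc 0 1 := hball hw
  rw [winding_coe, winding_coe]
  congr 1
  rw [← sub_eq_zero, ← hγ.curveInt_sub (continuousOn_inv_sub hw') (continuousOn_inv_sub hw₀)]
  refine hγ.curveInt_eq_zero (F := fun z => Complex.log (1 + (w₀ - w) * (z - w₀)⁻¹))
    ((continuousOn_inv_sub hw').sub (continuousOn_inv_sub hw₀)) fun z hz => ?_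
  have hz0 : z - w₀ ≠ 0 := fun h => hw₀ (by rwa [← sub_eq_zero.1 h])
  have hzw : z - w ≠ 0 := fun h => hw' (by rwa [← sub_eq_zero.1 h])
  have hzr : r ≤ ‖z - w₀‖ := by
    rw [← dist_eq_norm]
    exact not_lt.1 fun h => hball (Metric.mem_ball.2 h) hz
  have hlt : ‖(w₀ - w) * (z - w₀)⁻¹‖ < 1 := by
    rw [norm_mul, norm_inv, ← div_eq_mul_inv, div_lt_one (norm_pos_iff.2 hz0)]
    rw [Metric.mem_ball, dist_comm, dist_eq_norm] at hw
    exact hw.trans_le hzr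
  have h1 : HasDerivAt (fun z => 1 + (w₀ - w) * (z - w₀)⁻¹)
      ((w₀ - w) * (-1 / (z - w₀) ^ 2)) z :=
    ((((hasDerivAt_id z).sub_const w₀).inv hz0).const_mul (w₀ - w)).const_add 1
  have h2 := h1.clog (one_add_mem_slitPlane hlt)
  convert! h2 using 1
  have : 1 + (w₀ - w) * (z - w₀)⁻¹ = (z - w) / (z - w₀) := by field_simp; ring
  rw [this]
  field_simp
  ring

/-- If `|w|` exceeds `|z|` on the whole curve, `log (1 - z/w)` is a primitive of `1/(z - w)` there.
This makes the value `0` at `∞` the continuous one. -/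
theorem IsClosedCurve.winding_eq_zero_of_large (hγ : IsClosedCurve γ) :
    ∃ r : ℝ, ∀ w : ℂ, r < ‖w‖ → winding γ (w : OnePoint ℂ) = 0 := by
  obtain ⟨r, hr⟩ := hγ.isCompact_trace.isBounded.subset_closedBall 0
  refine ⟨max r 0, fun w hw => ?_⟩
  have hwr : r < ‖w‖ := (le_max_left _ _).trans_lt hw
  have hw0 : w ≠ 0 := norm_pos_iff.1 ((le_max_right _ _).trans_lt hw)
  have hw' : w ∉ γ '' Icc 0 1 := fun h => by simpa [hwr.not_ge] using hr h
  rw [winding_coe]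
  refine mul_eq_zero_of_right _ (hγ.curveInt_eq_zero (F := fun z => Complex.log (1 + z * (-w⁻¹)))
    (continuousOn_inv_sub hw') fun z hz => ?_)
  have hzr : ‖z‖ ≤ r := by simpa using hr hz
  have hzw : z - w ≠ 0 := fun h => hw' (by rwa [← sub_eq_zero.1 h])
  have hlt : ‖z * (-w⁻¹)‖ < 1 := by
    rw [norm_mul, norm_neg, norm_inv, ← div_eq_mul_inv, div_lt_one (norm_pos_iff.2 hw0)]
    exact hzr.trans_lt hwr
  have h1 : HasDerivAt (fun z => 1 + z * (-w⁻¹)) (1 * (-w⁻¹)) z :=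
    ((hasDerivAt_id z).mul_const _).const_add 1
  have h2 := h1.clog (one_add_mem_slitPlane hlt)
  convert! h2 using 1
  have : 1 + z * (-w⁻¹) = (w - z) / w := by field_simp; ring
  rw [this]
  have : w - z ≠ 0 := by rwa [← neg_ne_zero, neg_sub]
  field_simp
  ring

theorem IsClosedCurve.winding_eventually_eq_sphere (hγ : IsClosedCurve γ) {x : OnePoint ℂ}
    (hx : ∀ s ∈ Icc (0 : ℝ) 1, (γ s : OnePoint ℂ) ≠ x) :
    ∀ᶠ y in 𝓝 x, winding γ y = winding γ x := by
  induction x using OnePoint.rec with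
  | infty =>
    obtain ⟨r, hr⟩ := hγ.winding_eq_zero_of_large
    have := tendsto_nhds_infty_iff.1 (tendsto_id (x := 𝓝 (∞ : OnePoint ℂ))) r
    filter_upwards [this] with y hy
    induction y using OnePoint.rec with
    | infty => rfl
    | coe z => exact hr z (hy z rfl)
  | coe z =>
    rw [OnePoint.nhds_coe_eq, eventually_map]
    refine hγ.winding_eventually_eq ?_
    rintro ⟨s, hs, h⟩
    exact hx s hs (by rw [h])

end

section

/-! ### Principal parts -/

/-- The coefficient of `(z - a)⁻ᵏ` in the principal part of `R` at `a`. -/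
noncomputable def polarCoeff (R : RatFunc ℂ) (a : ℂ) (k : ℕ) : ℂ :=
  HahnSeries.coeff (RatFunc.laurent a R : ℂ⸨X⸩) (-(k : ℤ))

theorem X_sub_C_eq (a : ℂ) :
    (RatFunc.X - RatFunc.C a : RatFunc ℂ) =
      algebraMap ℂ[X] (RatFunc ℂ) (Polynomial.X - Polynomial.C a) := by
  simp

theorem pow_inv_eq (a : ℂ) (k : ℕ) : ((RatFunc.X - RatFunc.C a : RatFunc ℂ) ^ k)⁻¹ =
    algebraMap ℂ[X] (RatFunc ℂ) 1 /
      algebraMap ℂ[X] (RatFunc ℂ) ((Polynomial.X - Polynomial.C a) ^ k) := by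
  simp

theorem reg_pow_inv {a z : ℂ} (h : z ≠ a) (k : ℕ) :
    Reg ((RatFunc.X - RatFunc.C a : RatFunc ℂ) ^ k)⁻¹ z := by
  rw [pow_inv_eq]
  exact reg_div_of_eval_ne_zero _ (by simpa [sub_eq_zero] using fun h' => absurd h' h)

theorem val_pow_inv {a z : ℂ} (h : z ≠ a) (k : ℕ) :
    val ((RatFunc.X - RatFunc.C a : RatFunc ℂ) ^ k)⁻¹ z = ((z - a) ^ k)⁻¹ := by
  rw [pow_inv_eq, val_div_of_eval_ne_zero _ (by simpa [sub_eq_zero] using fun h' => absurd h' h)]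
  simp

theorem reg_principalPart (R : RatFunc ℂ) {a z : ℂ} (h : z ≠ a) : Reg (principalPart R a) z :=
  reg_sum _ _ fun _ _ => reg_mul (reg_C _ _) (reg_pow_inv h _)

theorem val_principalPart (R : RatFunc ℂ) {a z : ℂ} (h : z ≠ a) :
    val (principalPart R a) z = ∑ k ∈ Finset.Icc 1 (R.denom.rootMultiplicity a),
      polarCoeff R a k * ((z - a) ^ k)⁻¹ := by
  rw [principalPart, val_sum _ _ fun _ _ => reg_mul (reg_C _ _) (reg_pow_inv h _)]
  refine Finset.sum_congr rfl fun k _ => ?_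
  rw [val_mul (reg_C _ _) (reg_pow_inv h _), val_C, val_pow_inv h]
  rfl

theorem coe_algebraMap_eq (p : ℂ[X]) : ((algebraMap ℂ[X] (RatFunc ℂ) p : RatFunc ℂ) : ℂ⸨X⸩) =
    HahnSeries.ofPowerSeries ℤ ℂ (p : PowerSeries ℂ) := by
  rw [RatFunc.coe_coe]; simp [RatFunc.coePolynomial]

/-- Near `a`, a rational function is the sum of its principal part and a regular function. -/
theorem reg_sub_principalPart (R : RatFunc ℂ) (a : ℂ) : Reg (R - principalPart R a) a := by
  classical
  set m := R.denom.rootMultiplicity a with hm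
  obtain ⟨B, hB, hBa⟩ := Polynomial.exists_eq_pow_rootMultiplicity_mul_and_not_dvd
    R.denom R.denom_ne_zero a
  rw [← hm] at hB
  replace hBa : B.eval a ≠ 0 := fun h => hBa (Polynomial.dvd_iff_isRoot.2 h)
  set L : Polynomial ℂ := Polynomial.X - Polynomial.C a with hL
  have hL0 : algebraMap ℂ[X] (RatFunc ℂ) L ≠ 0 := algebraMap_ne_zero' (Polynomial.X_sub_C_ne_zero a)
  have hB0 : algebraMap ℂ[X] (RatFunc ℂ) B ≠ 0 :=
    algebraMap_ne_zero' (by rintro rfl; simp at hBa)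
  -- the Laurent series of `R` at `a`, multiplied by `X ^ m`, is a power series `h`
  have hunit : IsUnit
      (PowerSeries.constantCoeff ((Polynomial.taylor a B : ℂ[X]) : PowerSeries ℂ)) := by
    rw [isUnit_iff_ne_zero, ← PowerSeries.coeff_zero_eq_constantCoeff_apply, Polynomial.coeff_coe,
      Polynomial.taylor_coeff_zero]
    exact hBa
  obtain ⟨h, hh⟩ : ∃ h : PowerSeries ℂ,
      ((Polynomial.taylor a B : ℂ[X]) : PowerSeries ℂ) * h
        = ((Polynomial.taylor a R.num : ℂ[X]) : PowerSeries ℂ) := by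
    obtain ⟨u, hu⟩ := PowerSeries.isUnit_iff_constantCoeff.2 hunit
    exact ⟨↑u⁻¹ * _, by rw [← hu, ← mul_assoc, u.mul_inv, one_mul]⟩
  have hser : (RatFunc.laurent a R : ℂ⸨X⸩) * HahnSeries.single (m : ℤ) 1
      = HahnSeries.ofPowerSeries ℤ ℂ h := by
    have h1 : R * algebraMap ℂ[X] (RatFunc ℂ) L ^ m * algebraMap ℂ[X] (RatFunc ℂ) B
        = algebraMap ℂ[X] (RatFunc ℂ) R.num := by
      conv_lhs => rw [eq_num_div_denom R]
      rw [mul_assoc, ← map_pow, ← map_mul, ← hB, div_mul_cancel₀ _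
        (algebraMap_ne_zero' R.denom_ne_zero)]
    have h2 := congrArg (fun T : RatFunc ℂ => ((RatFunc.laurent a T : RatFunc ℂ) : ℂ⸨X⸩)) h1
    simp only [map_mul, map_pow, RatFunc.laurent_algebraMap] at h2
    rw [coe_algebraMap_eq, coe_algebraMap_eq, coe_algebraMap_eq, ← hh, map_mul] at h2
    have h3 : HahnSeries.ofPowerSeries ℤ ℂ ((Polynomial.taylor a L : ℂ[X]) : PowerSeries ℂ)
        = HahnSeries.single 1 1 := by
      rw [hL]; simp
    have h4 :
        HahnSeries.ofPowerSeries ℤ ℂ ((Polynomial.taylor a B : ℂ[X]) : PowerSeries ℂ) ≠ 0 := by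
      rw [Ne, map_eq_zero_iff _ HahnSeries.ofPowerSeries_injective]
      intro h0
      rw [h0] at hunit
      simp at hunit
    rw [h3, HahnSeries.single_pow, one_pow, mul_comm _ (HahnSeries.ofPowerSeries ℤ ℂ h)] at h2
    simpa using mul_right_cancel₀ h4 h2
  have hcoeff : ∀ k ≤ m, polarCoeff R a k = PowerSeries.coeff (m - k) h := by
    intro k hk
    have h1 := congrArg (fun s : ℂ⸨X⸩ => s.coeff ((m - k : ℕ) : ℤ)) hser
    simp only [LaurentSeries.coeff_coe_powerSeries] at h1
    rw [← h1, polarCoeff]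
    have : ((m - k : ℕ) : ℤ) = -(k : ℤ) + m := by omega
    rw [this, HahnSeries.coeff_mul_single_add, mul_one]
  -- the polynomial part of `h` below degree `m`, recentred at `a`
  set p : ℂ[X] := ∑ j ∈ Finset.range m, Polynomial.C (PowerSeries.coeff j h) * L ^ j with hp
  -- Recentred at `a`, the difference is `B (h - p)`, and `p` is the truncation of `h` at degree
  -- `m`.
  have hdvd : L ^ m ∣ R.num - B * p := by
    have ht : Polynomial.taylor a p = PowerSeries.trunc m h := by
      ext j
      simp [hp, hL, PowerSeries.coeff_trunc, Polynomial.coeff_X_pow]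
    have hX : Polynomial.X ^ m ∣ Polynomial.taylor a (R.num - B * p) := by
      rw [Polynomial.X_pow_dvd_iff]
      intro d hd
      rw [← Polynomial.coeff_coe, map_sub, Polynomial.taylor_mul, ht, Polynomial.coe_sub,
        Polynomial.coe_mul, ← hh,
        ← mul_sub, PowerSeries.coeff_mul]
      refine Finset.sum_eq_zero fun x hx => ?_
      have hx2 : x.2 < m := lt_of_le_of_lt
        (by rw [Finset.HasAntidiagonal.mem_antidiagonal] at hx; omega) hd
      rw [map_sub, Polynomial.coeff_coe, Polynomial.coeff_coe, PowerSeries.coeff_trunc, if_pos hx2,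
        sub_self, mul_zero]
    obtain ⟨c, hc⟩ := hX
    refine ⟨Polynomial.taylor (-a) c, Polynomial.taylor_injective a ?_⟩
    rw [hc, Polynomial.taylor_mul, Polynomial.taylor_taylor]
    simp [hL, Polynomial.taylor_pow]
  have hpp : principalPart R a =
      algebraMap ℂ[X] (RatFunc ℂ) p / algebraMap ℂ[X] (RatFunc ℂ) L ^ m := by
    rw [principalPart, ← hm, hp, map_sum, Finset.sum_div, ← Finset.sum_range_reflect]
    rw [show Finset.Icc 1 m = (Finset.range m).image (· + 1) by
      ext k; simp only [Finset.mem_Icc, Finset.mem_image, Finset.mem_range]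
      exact ⟨fun h => ⟨k - 1, by omega, by omega⟩, by rintro ⟨j, hj, rfl⟩; omega⟩,
      Finset.sum_image (by intro x _ y _ h; simpa using h)]
    refine Finset.sum_congr rfl fun k hk => ?_
    rw [Finset.mem_range] at hk
    have := hcoeff (k + 1) hk
    rw [polarCoeff] at this
    rw [this, X_sub_C_eq, ← hL, map_mul, map_pow, RatFunc.algebraMap_C,
      show m - 1 - k = m - (k + 1) by omega, div_eq_mul_inv, mul_assoc]
    congr 1
    rw [eq_comm, ← div_eq_mul_inv, div_eq_iff (pow_ne_zero _ hL0), inv_mul_eq_div,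
      eq_div_iff (pow_ne_zero _ hL0), ← pow_add]
    congr 1; omega
  obtain ⟨c, hc⟩ := hdvd
  -- Since `R.num = B p + L ^ m c`, division by `L ^ m B` splits off exactly `p / L ^ m`; what is
  -- left has denominator `B`, nonzero at `a`.
  have : R - principalPart R a = algebraMap ℂ[X] (RatFunc ℂ) c / algebraMap ℂ[X] (RatFunc ℂ) B := by
    have hN : algebraMap ℂ[X] (RatFunc ℂ) R.num =
        algebraMap ℂ[X] (RatFunc ℂ) B * algebraMap ℂ[X] (RatFunc ℂ) p
        + algebraMap ℂ[X] (RatFunc ℂ) L ^ m * algebraMap ℂ[X] (RatFunc ℂ) c := by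
      rw [← map_pow, ← map_mul, ← map_mul, ← map_add, ← hc]; congr 1; ring
    rw [hpp]
    conv_lhs => rw [eq_num_div_denom R, hB, hN, map_mul, map_pow]
    field_simp
    ring
  rw [this]
  exact reg_div_of_eval_ne_zero _ hBa

theorem exists_polynomial_of_reg {R : RatFunc ℂ} (h : ∀ z, Reg R z) :
    ∃ p : ℂ[X], R = algebraMap ℂ[X] (RatFunc ℂ) p := by
  have h1 : R.denom = 1 := by
    have hd : R.denom.degree = 0 := by
      by_contra h0
      obtain ⟨z, hz⟩ := IsAlgClosed.exists_root R.denom h0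
      exact h z hz
    exact (RatFunc.monic_denom R).eq_one_of_isUnit (Polynomial.isUnit_iff_degree_eq_zero.2 hd)
  exact ⟨R.num, by conv_lhs => rw [eq_num_div_denom R, h1, map_one, div_one]⟩

/-- Partial fractions: a rational function is the sum of a polynomial and its principal parts. -/
theorem exists_eq_polynomial_add_principalPart (q : RatFunc ℂ) :
    ∃ p : ℂ[X], q = algebraMap ℂ[X] (RatFunc ℂ) p + ∑ a ∈ finitePoles q, principalPart q a := by
  obtain ⟨p, hp⟩ := exists_polynomial_of_reg
    (R := q - ∑ a ∈ finitePoles q, principalPart q a) fun z => by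
      by_cases hz : z ∈ finitePoles q
      · rw [← Finset.add_sum_erase _ _ hz, ← sub_sub]
        refine reg_sub (reg_sub_principalPart q z) (reg_sum _ _ fun a ha => reg_principalPart q ?_)
        exact (Finset.ne_of_mem_erase ha).symm
      · refine reg_sub (reg_iff_notMem_finitePoles.2 hz)
          (reg_sum _ _ fun a ha => reg_principalPart q ?_)
        rintro rfl; exact hz ha
  exact ⟨p, by rw [← hp]; ring⟩

theorem val_eq_polynomial_add {q : RatFunc ℂ} {p : ℂ[X]}
    (hp : q = algebraMap ℂ[X] (RatFunc ℂ) p + ∑ a ∈ finitePoles q, principalPart q a)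
    {z : ℂ} (hz : z ∉ finitePoles q) :
    val q z = p.eval z + ∑ a ∈ finitePoles q, val (principalPart q a) z := by
  have h : ∀ a ∈ finitePoles q, Reg (principalPart q a) z := fun a ha =>
    reg_principalPart q (by rintro rfl; exact hz ha)
  conv_lhs => rw [hp]
  rw [val_add (reg_algebraMap _ _) (reg_sum _ _ h), val_algebraMap, val_sum _ _ h]

/-! ### The Cauchy integral of a rational function -/

variable {γ : ℝ → ℂ}

theorem two_pi_I_inv_ne_zero : (2 * Real.pi * Complex.I : ℂ)⁻¹ ≠ 0 :=
  inv_ne_zero Complex.two_pi_I_ne_zero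

/-- `(p(z) - p(w))/(z - w)` is a polynomial and integrates to zero. -/
theorem IsClosedCurve.cauchy_polynomial (hγ : IsClosedCurve γ) {w : ℂ} (hw : w ∉ γ '' Icc 0 1)
    (p : ℂ[X]) : (2 * Real.pi * Complex.I)⁻¹ * curveInt γ (fun z => p.eval z * (z - w)⁻¹)
      = winding γ w * p.eval w := by
  obtain ⟨c, hc⟩ := Polynomial.X_sub_C_dvd_sub_C_eval (a := w) (p := p)
  have h1 : EqOn (fun z => p.eval z * (z - w)⁻¹) (fun z => c.eval z + p.eval w * (z - w)⁻¹)
      (γ '' Icc 0 1) := fun z hz => by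
    have hzw : z - w ≠ 0 := fun h => hw (by rwa [← sub_eq_zero.1 h])
    have := congrArg (Polynomial.eval z) hc
    simp only [Polynomial.eval_sub, Polynomial.eval_mul, Polynomial.eval_X, Polynomial.eval_C]
      at this
    have h2 : p.eval z = (z - w) * c.eval z + p.eval w := by rw [← this]; ring
    simp only [h2]
    field_simp
  have h3 : ContinuousOn (fun z => p.eval w * (z - w)⁻¹) (γ '' Icc 0 1) :=
    continuousOn_const.mul (continuousOn_inv_sub hw)
  rw [curveInt_congr h1, hγ.curveInt_add (by fun_prop) h3, hγ.curveInt_polynomial, zero_add,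
    curveInt_const_mul, winding_coe]
  ring

/-- The identity `key` lowers the exponent by one, at the cost of an integral of a pure power of
`1/(z - a)`. That integral vanishes for exponent at least `2`; the exponent `1` alone produces
`μ(a)`. -/
theorem IsClosedCurve.cauchy_pow_inv (hγ : IsClosedCurve γ) {w a : ℂ} (hw : w ∉ γ '' Icc 0 1)
    (ha : a ∉ γ '' Icc 0 1) (hwa : w ≠ a) {k : ℕ} (hk : 1 ≤ k) :
    (2 * Real.pi * Complex.I)⁻¹ * curveInt γ (fun z => ((z - a) ^ k)⁻¹ * (z - w)⁻¹)
      = (winding γ w - winding γ a) * ((w - a) ^ k)⁻¹ := by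
  have hwa' : w - a ≠ 0 := sub_ne_zero.2 hwa
  have key : ∀ k : ℕ, curveInt γ (fun z => ((z - a) ^ (k + 1))⁻¹ * (z - w)⁻¹) = (w - a)⁻¹ *
      (curveInt γ (fun z => ((z - a) ^ k)⁻¹ * (z - w)⁻¹)
        - curveInt γ (fun z => ((z - a) ^ (k + 1))⁻¹)) := by
    intro k
    have hc : ContinuousOn (fun z => ((z - a) ^ k)⁻¹ * (z - w)⁻¹) (γ '' Icc 0 1) :=
      (continuousOn_pow_inv_sub ha k).mul (continuousOn_inv_sub hw)
    rw [← hγ.curveInt_sub hc (continuousOn_pow_inv_sub ha _), ← curveInt_const_mul]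
    refine curveInt_congr fun z hz => ?_
    have hzw : z - w ≠ 0 := fun h => hw (by rwa [← sub_eq_zero.1 h])
    have hza : z - a ≠ 0 := fun h => ha (by rwa [← sub_eq_zero.1 h])
    field_simp
    ring
  induction k, hk using Nat.le_induction with
  | base =>
    rw [key 0, winding_coe, winding_coe]
    simp only [pow_zero, inv_one, one_mul, zero_add, pow_one]
    ring
  | succ k hk ih =>
    obtain ⟨j, rfl⟩ := Nat.exists_eq_add_of_le' hk
    rw [key, hγ.curveInt_pow_inv ha, sub_zero, mul_left_comm, ih, pow_succ _ (j + 1), mul_inv]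
    ring

/-- The polynomial part contributes `μ(w) p(w)` and each pole `a` contributes `(μ(w) - μ(a))
q_a(w)`; the terms with `μ(w)` reassemble to `μ(w) q(w)`. -/
theorem IsClosedCurve.cauchy_val (hγ : IsClosedCurve γ) {q : RatFunc ℂ}
    (hq : ∀ z ∈ γ '' Icc 0 1, Reg q z) {w : ℂ} (hw : w ∉ γ '' Icc 0 1) (hqw : Reg q w) :
    (2 * Real.pi * Complex.I)⁻¹ * curveInt γ (fun z => val q z * (z - w)⁻¹)
      = winding γ w * val q w
        - ∑ a ∈ finitePoles q, winding γ (a : OnePoint ℂ) * val (principalPart q a) w := by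
  obtain ⟨p, hp⟩ := exists_eq_polynomial_add_principalPart q
  have hpoles : ∀ a ∈ finitePoles q, a ∉ γ '' Icc 0 1 := fun a ha h =>
    reg_iff_notMem_finitePoles.1 (hq a h) ha
  have hwp := reg_iff_notMem_finitePoles.1 hqw
  have h1 : EqOn (fun z => val q z * (z - w)⁻¹) (fun z => p.eval z * (z - w)⁻¹ +
      ∑ a ∈ finitePoles q, ∑ k ∈ Finset.Icc 1 (q.denom.rootMultiplicity a),
        polarCoeff q a k * (((z - a) ^ k)⁻¹ * (z - w)⁻¹)) (γ '' Icc 0 1) := fun z hz => by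
    have hzp := reg_iff_notMem_finitePoles.1 (hq z hz)
    simp only
    rw [val_eq_polynomial_add hp hzp, add_mul, Finset.sum_mul]
    refine congrArg _ (Finset.sum_congr rfl fun a ha => ?_)
    rw [val_principalPart q (by rintro rfl; exact hzp ha), Finset.sum_mul]
    exact Finset.sum_congr rfl fun k _ => mul_assoc _ _ _
  have hc : ∀ a ∈ finitePoles q, ∀ k, ContinuousOn
      (fun z => polarCoeff q a k * (((z - a) ^ k)⁻¹ * (z - w)⁻¹)) (γ '' Icc 0 1) := fun a ha k =>
    continuousOn_const.mul
      ((continuousOn_pow_inv_sub (hpoles a ha) k).mul (continuousOn_inv_sub hw))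
  have hcp : ContinuousOn (fun z => p.eval z * (z - w)⁻¹) (γ '' Icc 0 1) :=
    p.continuous.continuousOn.mul (continuousOn_inv_sub hw)
  rw [curveInt_congr h1, hγ.curveInt_add hcp
    (continuousOn_finsetSum _ fun a ha => continuousOn_finsetSum _ fun k _ => hc a ha k), mul_add,
    hγ.cauchy_polynomial hw, hγ.curveInt_sum _
    (fun a ha => continuousOn_finsetSum _ fun k _ => hc a ha k), val_eq_polynomial_add hp hwp,
    mul_add, Finset.mul_sum, Finset.mul_sum, add_sub_assoc, ← Finset.sum_sub_distrib]
  refine congrArg _ (Finset.sum_congr rfl fun a ha => ?_)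
  have hwa : w ≠ a := by rintro rfl; exact hwp ha
  rw [hγ.curveInt_sum _ fun k _ => hc a ha k, ← sub_mul, val_principalPart q hwa, Finset.mul_sum,
    Finset.mul_sum]
  refine Finset.sum_congr rfl fun k hk => ?_
  rw [curveInt_const_mul, mul_left_comm,
    hγ.cauchy_pow_inv hw (hpoles a ha) hwa (Finset.mem_Icc.1 hk).1]
  ring

/-- The integral of `q` along a curve with no pole of `q` inside vanishes. -/
theorem IsClosedCurve.curveInt_val_eq_zero (hγ : IsClosedCurve γ) {q : RatFunc ℂ}
    (hq : ∀ z ∈ γ '' Icc 0 1, Reg q z)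
    (hout : ∀ a ∈ finitePoles q, winding γ (a : OnePoint ℂ) = 0) : curveInt γ (val q) = 0 := by
  obtain ⟨p, hp⟩ := exists_eq_polynomial_add_principalPart q
  have hpoles : ∀ a ∈ finitePoles q, a ∉ γ '' Icc 0 1 := fun a ha h =>
    reg_iff_notMem_finitePoles.1 (hq a h) ha
  have h1 : EqOn (val q) (fun z => p.eval z +
      ∑ a ∈ finitePoles q, ∑ k ∈ Finset.Icc 1 (q.denom.rootMultiplicity a),
        polarCoeff q a k * ((z - a) ^ k)⁻¹) (γ '' Icc 0 1) := fun z hz => by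
    have hzp := reg_iff_notMem_finitePoles.1 (hq z hz)
    rw [val_eq_polynomial_add hp hzp]
    refine congrArg _ (Finset.sum_congr rfl fun a ha => ?_)
    rw [val_principalPart q (by rintro rfl; exact hzp ha)]
  have hc : ∀ a ∈ finitePoles q, ∀ k, ContinuousOn
      (fun z => polarCoeff q a k * ((z - a) ^ k)⁻¹) (γ '' Icc 0 1) := fun a ha k =>
    continuousOn_const.mul (continuousOn_pow_inv_sub (hpoles a ha) k)
  rw [curveInt_congr h1, hγ.curveInt_add (by fun_prop)
    (continuousOn_finsetSum _ fun a ha => continuousOn_finsetSum _ fun k _ => hc a ha k),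
    hγ.curveInt_polynomial, zero_add, hγ.curveInt_sum _
    (fun a ha => continuousOn_finsetSum _ fun k _ => hc a ha k)]
  refine Finset.sum_eq_zero fun a ha => ?_
  rw [hγ.curveInt_sum _ fun k _ => hc a ha k]
  refine Finset.sum_eq_zero fun k hk => ?_
  rw [curveInt_const_mul]
  refine mul_eq_zero_of_right _ ?_
  obtain ⟨j, rfl⟩ := Nat.exists_eq_add_of_le' (Finset.mem_Icc.1 hk).1
  -- Only the residue term, `k = 1`, depends on the winding number; higher powers have primitives.
  rcases j with _ | j
  · have := hout a ha
    rw [winding_coe, mul_eq_zero, or_iff_right two_pi_I_inv_ne_zero] at this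
    simpa using this
  · exact hγ.curveInt_pow_inv (hpoles a ha) j

end

section

/-! ### The fibres of a rational function -/

/-- The polynomial whose roots are the finite preimages of `t` under `P`. -/
noncomputable def fiberPoly (P : RatFunc ℂ) (t : ℂ) : ℂ[X] := P.num - Polynomial.C t * P.denom

/-- `t` has `deg P` distinct finite preimages under `P`. -/
def IsGenericValue (P : RatFunc ℂ) (t : ℂ) : Prop :=
  (fiberPoly P t).coeff (degree P) ≠ 0 ∧ (fiberPoly P t).Separable

open Classical in
/-- The finite preimages of `t` under `P`. -/
noncomputable def fiber (P : RatFunc ℂ) (t : ℂ) : Finset ℂ := (fiberPoly P t).roots.toFinset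

variable {P q : RatFunc ℂ} {t : ℂ}

theorem eval_fiberPoly (P : RatFunc ℂ) (t z : ℂ) :
    (fiberPoly P t).eval z = P.num.eval z - t * P.denom.eval z := by simp [fiberPoly]

theorem natDegree_fiberPoly_le (P : RatFunc ℂ) (t : ℂ) : (fiberPoly P t).natDegree ≤ degree P :=
  (Polynomial.natDegree_sub_le _ _).trans (max_le (natDegree_num_le P)
    ((Polynomial.natDegree_C_mul_le _ _).trans (natDegree_denom_le P)))

theorem eval_fiberPoly_of_reg {z : ℂ} (h : Reg P z) :
    (fiberPoly P t).eval z = (val P z - t) * P.denom.eval z := by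
  rw [eval_fiberPoly, val_def, sub_mul, div_mul_cancel₀ _ h]

theorem reg_of_eval_fiberPoly {z : ℂ} (h : (fiberPoly P t).eval z = 0) : Reg P z := fun h0 => by
  rw [eval_fiberPoly, h0, mul_zero, sub_zero] at h
  exact num_ne_zero_of_denom_eval_eq_zero h0 h

theorem val_of_eval_fiberPoly {z : ℂ} (h : (fiberPoly P t).eval z = 0) : val P z = t := by
  have hr := reg_of_eval_fiberPoly h
  rw [eval_fiberPoly_of_reg hr, mul_eq_zero, or_iff_left hr] at h
  exact sub_eq_zero.1 h

namespace IsGenericValue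

theorem ne_zero (h : IsGenericValue P t) : fiberPoly P t ≠ 0 := fun h0 => h.1 (by rw [h0]; simp)

theorem mem_fiber (h : IsGenericValue P t) {z : ℂ} :
    z ∈ fiber P t ↔ (fiberPoly P t).eval z = 0 := by
  simp [fiber, h.ne_zero]

theorem mem_fiber_iff (h : IsGenericValue P t) {z : ℂ} :
    z ∈ fiber P t ↔ sphereVal P z = (t : OnePoint ℂ) := by
  rw [h.mem_fiber]
  refine ⟨fun hz => by rw [sphereVal_of_reg (reg_of_eval_fiberPoly hz), val_of_eval_fiberPoly hz],
    fun hz => ?_⟩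
  have hr : Reg P z := reg_iff.2 (by rw [hz]; exact OnePoint.coe_ne_infty _)
  rw [sphereVal_of_reg hr] at hz
  rw [eval_fiberPoly_of_reg hr, OnePoint.coe_injective hz, sub_self, zero_mul]

theorem reg (h : IsGenericValue P t) {z : ℂ} (hz : z ∈ fiber P t) : Reg P z :=
  reg_of_eval_fiberPoly (h.mem_fiber.1 hz)

theorem val_eq (h : IsGenericValue P t) {z : ℂ} (hz : z ∈ fiber P t) : val P z = t :=
  val_of_eval_fiberPoly (h.mem_fiber.1 hz)

theorem natDegree_eq (h : IsGenericValue P t) : (fiberPoly P t).natDegree = degree P :=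
  (natDegree_fiberPoly_le P t).antisymm (Polynomial.le_natDegree_of_ne_zero h.1)

theorem card_fiber (h : IsGenericValue P t) : (fiber P t).card = degree P := by
  classical
  rw [← h.natDegree_eq, ← Polynomial.splits_iff_card_roots.1 (IsAlgClosed.splits (fiberPoly P t))]
  rw [fiber]
  convert Multiset.toFinset_card_of_nodup (Polynomial.nodup_roots h.2)

theorem derivative_ne_zero (h : IsGenericValue P t) {z : ℂ} (hz : z ∈ fiber P t) :
    (Polynomial.derivative (fiberPoly P t)).eval z ≠ 0 :=
  h.2.eval₂_derivative_ne_zero (RingHom.id ℂ) (h.mem_fiber.1 hz)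

/-- On the fibre `N = tD`, so the quotient rule `(N'D - ND')/D²` collapses to `(N' - tD')/D`. -/
theorem val_ratDeriv (h : IsGenericValue P t) {z : ℂ} (hz : z ∈ fiber P t) :
    val (ratDeriv P) z
      = (Polynomial.derivative (fiberPoly P t)).eval z / P.denom.eval z := by
  have hd : P.denom.eval z ≠ 0 := h.reg hz
  have hF := h.mem_fiber.1 hz
  rw [eval_fiberPoly, sub_eq_zero] at hF
  rw [ratDeriv, val_div_of_eval_ne_zero _ (by rw [Polynomial.eval_pow]; exact pow_ne_zero _ hd)]
  simp only [fiberPoly, Polynomial.eval_sub, Polynomial.eval_mul, Polynomial.eval_pow, hF,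
    Polynomial.derivative_sub, Polynomial.derivative_C_mul, Polynomial.eval_C]
  field_simp

theorem val_ratDeriv_ne_zero (h : IsGenericValue P t) {z : ℂ} (hz : z ∈ fiber P t) :
    val (ratDeriv P) z ≠ 0 := by
  rw [h.val_ratDeriv hz]
  exact div_ne_zero (h.derivative_ne_zero hz) (h.reg hz)

theorem coeff_ne (h : IsGenericValue P t) :
    P.num.coeff (degree P) - t * P.denom.coeff (degree P) ≠ 0 := by
  simpa [fiberPoly] using h.1

theorem recipAtInfty_eq (h : IsGenericValue P t) : recipAtInfty P t =
    P.denom.coeff (degree P) / (P.num.coeff (degree P) - t * P.denom.coeff (degree P)) := by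
  have h1 := h.coeff_ne
  rw [recipAtInfty, sphereVal_infty, sphereQuot]
  split_ifs with h0
  · simp [h0]
  · simp only [OnePoint.elim_some]
    rw [← inv_div]
    field_simp

theorem sphereVal_infty_ne (h : IsGenericValue P t) : sphereVal P ∞ ≠ (t : OnePoint ℂ) := by
  have h1 := h.coeff_ne
  rw [sphereVal_infty, sphereQuot]
  split_ifs with h0
  · exact OnePoint.infty_ne_coe t
  · intro h2
    refine h1 ?_
    rw [← OnePoint.coe_injective h2, div_mul_cancel₀ _ h0, sub_self]

/-- The cofactor of `X - w` in the polynomial of the fibre. -/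
theorem X_sub_C_mul_divByMonic (h : IsGenericValue P t) {w : ℂ} (hw : w ∈ fiber P t) :
    (Polynomial.X - Polynomial.C w) * (fiberPoly P t /ₘ (Polynomial.X - Polynomial.C w))
      = fiberPoly P t :=
  Polynomial.mul_divByMonic_eq_iff_isRoot.2 (h.mem_fiber.1 hw)

/-- Lagrange interpolation of the denominator of `P` at the fibre. -/
theorem denom_eq (h : IsGenericValue P t) :
    P.denom = Polynomial.C (recipAtInfty P t) * fiberPoly P t + ∑ w ∈ fiber P t,
      Polynomial.C (val (ratDeriv P) w)⁻¹ *
        (fiberPoly P t /ₘ (Polynomial.X - Polynomial.C w)) := by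
  rw [← sub_eq_iff_eq_add']
  -- The multiple of `fiberPoly P t` is chosen to cancel the coefficient of degree `n`. Both sides
  -- then have degree below `n`, so agreement at the `n` fibre points suffices.
  refine Polynomial.eq_of_degree_sub_lt_of_eval_finset_eq (fiber P t) ?_ fun z hz => ?_
  · rw [h.card_fiber, ← Polynomial.mem_degreeLT]
    refine Submodule.sub_mem _ ?_ (Submodule.sum_mem _ fun w hw => ?_)
    · rw [Polynomial.mem_degreeLT, Polynomial.degree_lt_iff_coeff_zero]
      intro m hm
      rcases hm.eq_or_lt with rfl | hm
      · rw [Polynomial.coeff_sub, Polynomial.coeff_C_mul, h.recipAtInfty_eq]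
        have h1 := h.coeff_ne
        simp only [fiberPoly, Polynomial.coeff_sub, Polynomial.coeff_C_mul]
        rw [div_mul_cancel₀ _ h1, sub_self]
      · refine Polynomial.coeff_eq_zero_of_natDegree_lt (lt_of_le_of_lt ?_ hm)
        exact (Polynomial.natDegree_sub_le _ _).trans (max_le (natDegree_denom_le P)
          ((Polynomial.natDegree_C_mul_le _ _).trans (natDegree_fiberPoly_le P t)))
    · rw [← Polynomial.smul_eq_C_mul]
      refine Submodule.smul_mem _ _ ?_
      rw [Polynomial.mem_degreeLT]
      refine (Polynomial.degree_divByMonic_lt _ (Polynomial.X - Polynomial.C w) h.ne_zero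
        (by rw [Polynomial.degree_X_sub_C]; exact zero_lt_one)).trans_le ?_
      rw [Polynomial.degree_eq_natDegree h.ne_zero, h.natDegree_eq]
  · rw [Polynomial.eval_sub, Polynomial.eval_mul, h.mem_fiber.1 hz, mul_zero, sub_zero,
      Polynomial.eval_finsetSum, Finset.sum_eq_single z]
    · have h1 := congrArg (fun p => (Polynomial.derivative p).eval z) (h.X_sub_C_mul_divByMonic hz)
      simp only [Polynomial.derivative_mul, Polynomial.derivative_sub, Polynomial.derivative_X,
        Polynomial.derivative_C, sub_zero, one_mul, Polynomial.eval_add, Polynomial.eval_mul,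
        Polynomial.eval_sub, Polynomial.eval_X, Polynomial.eval_C, sub_self, zero_mul, add_zero]
        at h1
      rw [Polynomial.eval_mul, Polynomial.eval_C, h1, h.val_ratDeriv hz, inv_div,
        div_mul_cancel₀ _ (h.derivative_ne_zero hz)]
    · intro w hw hwz
      have h1 := congrArg (Polynomial.eval z) (h.X_sub_C_mul_divByMonic hw)
      rw [h.mem_fiber.1 hz] at h1
      simp only [Polynomial.eval_mul, Polynomial.eval_sub, Polynomial.eval_X, Polynomial.eval_C,
        mul_eq_zero] at h1
      rw [Polynomial.eval_mul, h1.resolve_left (sub_ne_zero.2 hwz.symm), mul_zero]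
    · exact fun h' => absurd hz h'

/-- This is `denom_eq` divided by `fiberPoly P t`, since `1/(P - t) = D/F_t`. -/
theorem inv_val_sub (h : IsGenericValue P t) {z : ℂ} (hz : Reg P z)
    (hzt : val P z ≠ t) : (val P z - t)⁻¹ =
      recipAtInfty P t + ∑ w ∈ fiber P t, (val (ratDeriv P) w)⁻¹ * (z - w)⁻¹ := by
  have hd : P.denom.eval z ≠ 0 := hz
  have hF : (fiberPoly P t).eval z ≠ 0 := by
    rw [eval_fiberPoly_of_reg hz]; exact mul_ne_zero (sub_ne_zero.2 hzt) hz
  have h1 : (val P z - t)⁻¹ = P.denom.eval z / (fiberPoly P t).eval z := by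
    rw [eval_fiberPoly_of_reg hz]; field_simp
  have h2 := congrArg (Polynomial.eval z) (h.denom_eq)
  rw [h1, h2, Polynomial.eval_add, Polynomial.eval_mul, Polynomial.eval_C, add_div,
    mul_div_cancel_right₀ _ hF, Polynomial.eval_finsetSum, Finset.sum_div]
  refine congrArg _ (Finset.sum_congr rfl fun w hw => ?_)
  rw [Polynomial.eval_mul, Polynomial.eval_C, mul_div_assoc]
  congr 1
  have h3 := congrArg (Polynomial.eval z) (h.X_sub_C_mul_divByMonic hw)
  simp only [Polynomial.eval_mul, Polynomial.eval_sub, Polynomial.eval_X, Polynomial.eval_C] at h3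
  rw [← h3] at hF ⊢
  have h4 := left_ne_zero_of_mul hF
  have h5 := right_ne_zero_of_mul hF
  field_simp

end IsGenericValue

theorem eventually_sub_mul_ne_zero {a b : ℂ} (h : (a, b) ≠ (0 : ℂ × ℂ)) :
    ∀ᶠ t : ℂ in cofinite, a - t * b ≠ 0 := by
  by_cases hb : b = 0
  · subst hb
    exact Eventually.of_forall fun t h0 => h (by simpa using h0)
  · filter_upwards [(finite_singleton (a / b)).compl_mem_cofinite] with t ht h0
    exact ht (by rw [mem_singleton_iff, eq_div_iff hb]; linear_combination -h0)

/-- If it vanished, coprimality would give `D ∣ D'` and `N ∣ N'`; in characteristic zero both would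
be constant. -/
theorem wronskian_ne_zero (hP : 0 < degree P) :
    Polynomial.derivative P.num * P.denom - P.num * Polynomial.derivative P.denom ≠ 0 := by
  intro h0
  rw [sub_eq_zero] at h0
  have hd : P.denom ∣ Polynomial.derivative P.denom :=
    P.isCoprime_num_denom.symm.dvd_of_dvd_mul_left ⟨Polynomial.derivative P.num, by
      rw [← h0, mul_comm]⟩
  have hn : P.num ∣ Polynomial.derivative P.num :=
    P.isCoprime_num_denom.dvd_of_dvd_mul_right ⟨Polynomial.derivative P.denom, h0⟩
  have hd' := Polynomial.derivative_eq_zero.1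
    (Polynomial.dvd_derivative_iff.1 hd)
  have hn' := Polynomial.derivative_eq_zero.1
    (Polynomial.dvd_derivative_iff.1 hn)
  rw [degree, hd', hn'] at hP
  exact lt_irrefl _ hP

/-- Excluded are `P(∞)`, where the degree drops, and the values at zeros of the Wronskian `W`: since
`D F_t' - D' F_t = W`, a multiple root of `F_t` is such a zero. -/
theorem eventually_isGenericValue (hP : 0 < degree P) :
    ∀ᶠ t : ℂ in cofinite, IsGenericValue P t := by
  set W := Polynomial.derivative P.num * P.denom - P.num * Polynomial.derivative P.denom with hW
  have hfin : (val P '' W.rootSet ℂ).Finite := (W.rootSet_finite ℂ).image _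
  filter_upwards [eventually_sub_mul_ne_zero (leadingCoeff_num_or_denom P),
    hfin.compl_mem_cofinite] with t h1 h2
  refine ⟨by simpa [fiberPoly] using h1, ?_⟩
  rw [Polynomial.separable_def,
    Polynomial.isCoprime_iff_aeval_ne_zero_of_isAlgClosed ℂ ℂ]
  intro z
  by_contra! hz
  simp only [Polynomial.coe_aeval_eq_eval] at hz
  refine h2 ⟨z, ?_, val_of_eval_fiberPoly hz.1⟩
  rw [Polynomial.mem_rootSet]
  refine ⟨wronskian_ne_zero hP, ?_⟩
  have h3 := hz.1
  have h4 := hz.2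
  simp only [fiberPoly, Polynomial.derivative_sub, Polynomial.derivative_C_mul,
    Polynomial.eval_sub, Polynomial.eval_mul, Polynomial.eval_C] at h3 h4
  simp only [hW, Polynomial.coe_aeval_eq_eval, Polynomial.eval_sub, Polynomial.eval_mul]
  linear_combination P.denom.eval z * h4 - (Polynomial.derivative P.denom).eval z * h3

/-- Only finitely many fibres meet the poles of `q`. -/
theorem eventually_reg_fiber (P q : RatFunc ℂ) :
    ∀ᶠ t : ℂ in cofinite, IsGenericValue P t → ∀ w ∈ fiber P t, Reg q w := by
  have hfin : (val P '' (finitePoles q : Set ℂ)).Finite := (finitePoles q).finite_toSet.image _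
  filter_upwards [hfin.compl_mem_cofinite] with t ht h w hw
  rw [reg_iff_notMem_finitePoles]
  exact fun h' => ht ⟨w, h', h.val_eq hw⟩

theorem eventually_cobounded_of_cofinite {p : ℂ → Prop} (h : ∀ᶠ t in cofinite, p t) :
    ∀ᶠ t in Bornology.cobounded ℂ, p t := Bornology.le_cofinite ℂ h

/-- The Cauchy-type integral, as a sum over a fibre. -/
theorem IsClosedCurve.IFun_eq {γ : ℝ → ℂ} (hγ : IsClosedCurve γ)
    (hPγ : ∀ z ∈ γ '' Icc 0 1, Reg P z) (hqγ : ∀ z ∈ γ '' Icc 0 1, Reg q z)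
    (h : IsGenericValue P t) (hqt : ∀ w ∈ fiber P t, Reg q w)
    (hPt : ∀ z ∈ γ '' Icc 0 1, val P z ≠ t) :
    IFun q P γ t = ∑ w ∈ fiber P t, (val (ratDeriv P) w)⁻¹ * (winding γ w * val q w
        - ∑ a ∈ finitePoles q, winding γ (a : OnePoint ℂ) * val (principalPart q a) w)
      + (2 * Real.pi * Complex.I)⁻¹ * recipAtInfty P t * curveInt γ (val q) := by
  have hwγ : ∀ w ∈ fiber P t, w ∉ γ '' Icc 0 1 := fun w hw hw' => hPt w hw' (h.val_eq hw)
  have hqc : ContinuousOn (val q) (γ '' Icc 0 1) := fun z hz =>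
    (continuousAt_val (hqγ z hz)).continuousWithinAt
  have hc : ∀ w ∈ fiber P t, ContinuousOn
      (fun z => (val (ratDeriv P) w)⁻¹ * (val q z * (z - w)⁻¹)) (γ '' Icc 0 1) := fun w hw =>
    continuousOn_const.mul (hqc.mul (continuousOn_inv_sub (hwγ w hw)))
  have h1 : EqOn (fun z => val q z / (val P z - t)) (fun z => recipAtInfty P t * val q z +
      ∑ w ∈ fiber P t, (val (ratDeriv P) w)⁻¹ * (val q z * (z - w)⁻¹)) (γ '' Icc 0 1) :=
    fun z hz => by
      simp only
      rw [div_eq_mul_inv, h.inv_val_sub (hPγ z hz) (hPt z hz), mul_add, Finset.mul_sum,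
        mul_comm (val q z)]
      exact congrArg _ (Finset.sum_congr rfl fun w _ => by ring)
  have h2 : IFun q P γ t = (2 * Real.pi * Complex.I)⁻¹ *
      curveInt γ (fun z => val q z / (val P z - t)) := rfl
  have h3 : ContinuousOn (fun z => recipAtInfty P t * val q z) (γ '' Icc 0 1) :=
    continuousOn_const.mul hqc
  rw [h2, curveInt_congr h1, hγ.curveInt_add h3 (continuousOn_finsetSum _ hc), hγ.curveInt_sum _ hc,
    curveInt_const_mul, mul_add, add_comm, Finset.mul_sum]
  congr 1
  · refine Finset.sum_congr rfl fun w hw => ?_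
    rw [curveInt_const_mul, mul_left_comm, hγ.cauchy_val hqγ (hwγ w hw) (hqt w hw)]
  · ring

end

section

/-! ### Sums over fibres are rational functions -/

/-- `f` coincides with a rational function outside a finite set. -/
def IsRat (f : ℂ → ℂ) : Prop := ∃ R : RatFunc ℂ, ∀ᶠ t in cofinite, f t = val R t

namespace IsRat

variable {f g : ℂ → ℂ}

theorem congr (hf : IsRat f) (h : ∀ᶠ t in cofinite, g t = f t) : IsRat g := by
  obtain ⟨R, hR⟩ := hf
  exact ⟨R, by filter_upwards [hR, h] with t h1 h2 using h2.trans h1⟩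

theorem const (c : ℂ) : IsRat fun _ => c :=
  ⟨RatFunc.C c, Eventually.of_forall fun t => (val_C c t).symm⟩

theorem id : IsRat fun t => t :=
  ⟨RatFunc.X, Eventually.of_forall fun t => by
    rw [← RatFunc.algebraMap_X, val_algebraMap, Polynomial.eval_X]⟩

theorem add (hf : IsRat f) (hg : IsRat g) : IsRat fun t => f t + g t := by
  obtain ⟨R, hR⟩ := hf
  obtain ⟨S, hS⟩ := hg
  refine ⟨R + S, ?_⟩
  filter_upwards [hR, hS, reg_eventually R, reg_eventually S] with t h1 h2 h3 h4
  rw [h1, h2, val_add h3 h4]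

theorem mul (hf : IsRat f) (hg : IsRat g) : IsRat fun t => f t * g t := by
  obtain ⟨R, hR⟩ := hf
  obtain ⟨S, hS⟩ := hg
  refine ⟨R * S, ?_⟩
  filter_upwards [hR, hS, reg_eventually R, reg_eventually S] with t h1 h2 h3 h4
  rw [h1, h2, val_mul h3 h4]

theorem sub (hf : IsRat f) (hg : IsRat g) : IsRat fun t => f t - g t :=
  (hf.add ((const (-1)).mul hg)).congr (Eventually.of_forall fun t => by ring)

theorem inv (hf : IsRat f) : IsRat fun t => (f t)⁻¹ := by
  obtain ⟨R, hR⟩ := hf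
  by_cases hR0 : R = 0
  · refine ⟨0, ?_⟩
    filter_upwards [hR] with t h1
    rw [h1, hR0]
    simp [val_def]
  · refine ⟨R⁻¹, ?_⟩
    have hn : ∀ᶠ t in cofinite, R.num.eval t ≠ 0 := by
      have : {t | ¬ R.num.eval t ≠ 0} ⊆ R.num.rootSet ℂ := fun t ht => by
        simpa [Polynomial.mem_rootSet, hR0] using ht
      exact (R.num.rootSet_finite ℂ).subset this
    filter_upwards [hR, hn, reg_eventually R] with t h1 h2 h3
    rw [h1, val_inv (div_ne_zero h2 h3)]

theorem div (hf : IsRat f) (hg : IsRat g) : IsRat fun t => f t / g t :=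
  (hf.mul hg.inv).congr (Eventually.of_forall fun _ => div_eq_mul_inv _ _)

theorem sum {ι : Type*} (s : Finset ι) {F : ι → ℂ → ℂ} (hF : ∀ i ∈ s, IsRat (F i)) :
    IsRat fun t => ∑ i ∈ s, F i t := by
  classical
  induction s using Finset.induction_on with
  | empty => simpa using const 0
  | insert a s ha ih =>
    simp only [Finset.sum_insert ha]
    exact (hF a (by simp)).add (ih fun i hi => hF i (by simp [hi]))

/-- The coefficients of the quotient of two power series with rational coefficients are
rational. -/
theorem of_antidiagonal {a s r : ℕ → ℂ → ℂ} (ha : ∀ k, IsRat (a k)) (hr : ∀ k, IsRat (r k))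
    (ha0 : ∀ᶠ t in cofinite, a 0 t ≠ 0)
    (h : ∀ k, ∀ᶠ t in cofinite,
      ∑ x ∈ Finset.HasAntidiagonal.antidiagonal k, a x.1 t * s x.2 t = r k t) (k : ℕ) :
    IsRat (s k) := by
  induction k using Nat.strong_induction_on with
  | _ k ih =>
    -- Solve the `k`-th equation for `s k`; every other term involves an earlier coefficient of `s`.
    have h1 : IsRat fun t => (r k t - ∑ x ∈ (Finset.HasAntidiagonal.antidiagonal k).erase (0, k),
        a x.1 t * s x.2 t) / a 0 t := by
      refine ((hr k).sub (IsRat.sum _ fun x hx => (ha _).mul (ih _ ?_))).div (ha 0)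
      rw [Finset.mem_erase, Finset.HasAntidiagonal.mem_antidiagonal] at hx
      rcases Nat.eq_zero_or_pos x.1 with h0 | h0
      · exact absurd (Prod.ext h0 (by simp only; omega)) hx.1
      · omega
    refine h1.congr ?_
    filter_upwards [ha0, h k] with t h2 h3
    rw [← h3, ← Finset.add_sum_erase _ _ (show (0, k) ∈ Finset.HasAntidiagonal.antidiagonal k by
      simp), add_sub_cancel_right, mul_div_cancel_left₀ _ h2]

end IsRat

variable {P q : RatFunc ℂ}

theorem isRat_fiberPoly_coeff (P : RatFunc ℂ) (φ : ℂ[X] →ₗ[ℂ] ℂ) :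
    IsRat fun t => φ (fiberPoly P t) := by
  have : (fun t => φ (fiberPoly P t)) = fun t => φ P.num - t * φ P.denom := by
    funext t
    rw [fiberPoly, map_sub, ← Polynomial.smul_eq_C_mul, map_smul, smul_eq_mul]
  rw [this]
  exact (IsRat.const _).sub (IsRat.id.mul (IsRat.const _))

theorem isRat_recipAtInfty (hP : 0 < degree P) : IsRat (recipAtInfty P) := by
  refine IsRat.congr ((IsRat.const (P.denom.coeff (degree P))).div
    ((IsRat.const (P.num.coeff (degree P))).sub
      (IsRat.id.mul (IsRat.const (P.denom.coeff (degree P)))))) ?_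
  filter_upwards [eventually_isGenericValue hP] with t ht using ht.recipAtInfty_eq

/-- Division of a polynomial by `X - v`, in terms of the expansion of `1 / (X - v)` at `0`. -/
theorem coeff_of_eq_X_sub_C_mul {f Q : ℂ[X]} {v : ℂ} (hv : v ≠ 0)
    (h : (Polynomial.X - Polynomial.C v) * Q = f) (k : ℕ) :
    ∑ x ∈ Finset.HasAntidiagonal.antidiagonal k, f.coeff x.1 * -(v ^ (x.2 + 1))⁻¹ = Q.coeff k := by
  have h1 : (PowerSeries.X - PowerSeries.C v : PowerSeries ℂ)
      * PowerSeries.mk (fun j => -(v ^ (j + 1))⁻¹) = 1 := by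
    ext j
    rcases j with _ | j
    · simp [sub_mul, hv]
    · rw [sub_mul, map_sub, PowerSeries.coeff_succ_X_mul, PowerSeries.coeff_C_mul,
        PowerSeries.coeff_mk, PowerSeries.coeff_mk, PowerSeries.coeff_one, if_neg (by omega)]
      field_simp
      ring
  have h2 : (f : PowerSeries ℂ) * PowerSeries.mk (fun j => -(v ^ (j + 1))⁻¹) = Q := by
    rw [← h, Polynomial.coe_mul, Polynomial.coe_sub, Polynomial.coe_X, Polynomial.coe_C,
      mul_right_comm, h1, one_mul]
  have h3 := congrArg (PowerSeries.coeff k) h2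
  rw [PowerSeries.coeff_mul, Polynomial.coeff_coe] at h3
  simpa using h3

/-- Division of a polynomial by `1 - v X`. -/
theorem coeff_of_eq_one_sub_C_mul_X_mul {f Q : ℂ[X]} {v : ℂ}
    (h : (1 - Polynomial.C v * Polynomial.X) * Q = f) (k : ℕ) :
    ∑ x ∈ Finset.HasAntidiagonal.antidiagonal k, f.coeff x.1 * v ^ x.2 = Q.coeff k := by
  have h1 : (1 - PowerSeries.C v * PowerSeries.X : PowerSeries ℂ)
      * PowerSeries.mk (fun j => v ^ j) = 1 := by
    ext j
    rcases j with _ | j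
    · simp [sub_mul]
    · rw [sub_mul, map_sub, one_mul, mul_assoc, PowerSeries.coeff_C_mul,
        PowerSeries.coeff_succ_X_mul,
        PowerSeries.coeff_mk, PowerSeries.coeff_mk, PowerSeries.coeff_one, if_neg (by omega)]
      ring
  have h2 : (f : PowerSeries ℂ) * PowerSeries.mk (fun j => v ^ j) = Q := by
    rw [← h, Polynomial.coe_mul, Polynomial.coe_sub, Polynomial.coe_mul, Polynomial.coe_X,
      Polynomial.coe_C, Polynomial.coe_one, mul_right_comm, h1, one_mul]
  have h3 := congrArg (PowerSeries.coeff k) h2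
  rw [PowerSeries.coeff_mul, Polynomial.coeff_coe] at h3
  simpa using h3

/-- The source of all rationality: the right-hand side does not mention the fibre, and `fiberPoly P
t` is affine in `t`. -/
theorem IsGenericValue.sum_map_divByMonic {t : ℂ} (h : IsGenericValue P t)
    (φ : ℂ[X] →ₗ[ℂ] ℂ) : ∑ w ∈ fiber P t, (val (ratDeriv P) w)⁻¹ *
      φ (fiberPoly P t /ₘ (Polynomial.X - Polynomial.C w))
      = φ P.denom - recipAtInfty P t * φ (fiberPoly P t) := by
  have h1 := congrArg φ (h.denom_eq)
  simp only [map_add, ← Polynomial.smul_eq_C_mul, map_smul, smul_eq_mul, map_sum] at h1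
  rw [h1]; ring

theorem isRat_fiber_aux (hP : 0 < degree P) (φ : ℂ[X] →ₗ[ℂ] ℂ) :
    IsRat fun t => ∑ w ∈ fiber P t, (val (ratDeriv P) w)⁻¹ *
      φ (fiberPoly P t /ₘ (Polynomial.X - Polynomial.C w)) := by
  refine IsRat.congr ((IsRat.const (φ P.denom)).sub
    ((isRat_recipAtInfty hP).mul (isRat_fiberPoly_coeff P φ))) ?_
  filter_upwards [eventually_isGenericValue hP] with t ht using ht.sum_map_divByMonic φ

/-- Expanding `F_t/(X - w)` at `a` writes its Taylor coefficients as the convolution of those of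
`F_t` with the numbers `-(w - a)^{-(j+1)}`. Summed over the fibre, this is the recursion of
`IsRat.of_antidiagonal`, with leading coefficient `F_t(a)`. -/
theorem isRat_fiber_pow_inv (hP : 0 < degree P) (a : ℂ) (k : ℕ) :
    IsRat fun t => ∑ w ∈ fiber P t, (val (ratDeriv P) w)⁻¹ * ((w - a) ^ (k + 1))⁻¹ := by
  set φ : ℕ → ℂ[X] →ₗ[ℂ] ℂ := fun j => (Polynomial.lcoeff ℂ j).comp (Polynomial.taylor a) with hφ
  have h0 : ∀ᶠ t in cofinite, (fiberPoly P t).eval a ≠ 0 := by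
    simp only [eval_fiberPoly]
    refine eventually_sub_mul_ne_zero fun h0 => ?_
    rw [Prod.mk_eq_zero] at h0
    exact num_ne_zero_of_denom_eval_eq_zero h0.2 h0.1
  have h0' : ∀ t, φ 0 (fiberPoly P t) = (fiberPoly P t).eval a := fun t => by
    simp [hφ, Polynomial.taylor_coeff_zero]
  have key := IsRat.of_antidiagonal (a := fun j t => φ j (fiberPoly P t))
    (s := fun j t => ∑ w ∈ fiber P t, (val (ratDeriv P) w)⁻¹ * -((w - a) ^ (j + 1))⁻¹)
    (r := fun j t => ∑ w ∈ fiber P t, (val (ratDeriv P) w)⁻¹ *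
      φ j (fiberPoly P t /ₘ (Polynomial.X - Polynomial.C w)))
    (fun j => isRat_fiberPoly_coeff P (φ j)) (fun j => isRat_fiber_aux hP (φ j))
    (by simpa only [h0'] using h0) (fun j => ?_) k
  · exact ((IsRat.const (-1)).mul key).congr (Eventually.of_forall fun t => by
      simp [Finset.sum_neg_distrib])
  · filter_upwards [eventually_isGenericValue hP, h0] with t ht hta
    simp only [Finset.mul_sum]
    rw [Finset.sum_comm]
    refine Finset.sum_congr rfl fun w hw => ?_
    have hwa : w - a ≠ 0 := fun h => hta (by rw [← sub_eq_zero.1 h]; exact ht.mem_fiber.1 hw)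
    have h1 := congrArg (Polynomial.taylor a) (ht.X_sub_C_mul_divByMonic hw)
    rw [Polynomial.taylor_mul, show Polynomial.taylor a (Polynomial.X - Polynomial.C w)
      = Polynomial.X - Polynomial.C (w - a) by simp; ring] at h1
    have h2 := coeff_of_eq_X_sub_C_mul hwa h1 j
    simp only [hφ, LinearMap.comp_apply, Polynomial.lcoeff_apply]
    refine Eq.trans ?_ (congrArg _ h2)
    rw [Finset.mul_sum]
    exact Finset.sum_congr rfl fun x _ => by ring

/-- The same recursion at infinity: reflection turns `X - w` into `1 - wX`, whose inverse generates
the powers of `w`, and the leading coefficient is that of `F_t` in degree `n`. -/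
theorem isRat_fiber_pow (hP : 0 < degree P) (k : ℕ) :
    IsRat fun t => ∑ w ∈ fiber P t, (val (ratDeriv P) w)⁻¹ * w ^ k := by
  set φ : ℕ → ℕ → ℂ[X] →ₗ[ℂ] ℂ := fun N j =>
    { toFun := fun p => (p.reflect N).coeff j
      map_add' := fun p r => by simp [Polynomial.reflect_add]
      map_smul' := fun c p => by simp [Polynomial.smul_eq_C_mul, Polynomial.reflect_C_mul] } with hφ
  have h0' : ∀ t, φ (degree P) 0 (fiberPoly P t) = (fiberPoly P t).coeff (degree P) := fun t => by
    simp [hφ, Polynomial.coeff_reflect, Polynomial.revAt_le]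
  refine IsRat.of_antidiagonal (a := fun j t => φ (degree P) j (fiberPoly P t))
    (s := fun j t => ∑ w ∈ fiber P t, (val (ratDeriv P) w)⁻¹ * w ^ j)
    (r := fun j t => ∑ w ∈ fiber P t, (val (ratDeriv P) w)⁻¹ *
      φ (degree P - 1) j (fiberPoly P t /ₘ (Polynomial.X - Polynomial.C w)))
    (fun j => isRat_fiberPoly_coeff P _) (fun j => isRat_fiber_aux hP _)
    (by
      simp only [h0']
      filter_upwards [eventually_isGenericValue hP] with t ht using ht.1) (fun j => ?_) k
  filter_upwards [eventually_isGenericValue hP] with t ht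
  simp only [Finset.mul_sum]
  rw [Finset.sum_comm]
  refine Finset.sum_congr rfl fun w hw => ?_
  -- The quotient is reflected in degree `n - 1`, so that the degrees of the two reflected factors
  -- add up to `n`.
  have hQ : (fiberPoly P t /ₘ (Polynomial.X - Polynomial.C w)).natDegree ≤ degree P - 1 := by
    rw [Polynomial.natDegree_divByMonic _ (Polynomial.monic_X_sub_C w), ht.natDegree_eq,
      Polynomial.natDegree_X_sub_C]
  have h1 := congrArg (Polynomial.reflect (1 + (degree P - 1))) (ht.X_sub_C_mul_divByMonic hw)
  rw [Polynomial.reflect_mul _ _ (Polynomial.natDegree_X_sub_C_le w) hQ,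
    show Polynomial.reflect 1 (Polynomial.X - Polynomial.C w)
      = 1 - Polynomial.C w * Polynomial.X by
        rw [Polynomial.reflect_sub, Polynomial.reflect_C, pow_one]; simp,
    Nat.add_sub_cancel' hP] at h1
  have h2 := coeff_of_eq_one_sub_C_mul_X_mul h1 j
  refine Eq.trans ?_ (congrArg _ h2)
  rw [Finset.mul_sum]
  exact Finset.sum_congr rfl fun x _ => by simp only [hφ, LinearMap.coe_mk, AddHom.coe_mk]; ring

theorem isRat_fiber_principalPart (hP : 0 < degree P) (q : RatFunc ℂ) (a : ℂ) :
    IsRat fun t => ∑ w ∈ fiber P t, (val (ratDeriv P) w)⁻¹ * val (principalPart q a) w := by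
  have h1 : IsRat fun t => ∑ k ∈ Finset.Icc 1 (q.denom.rootMultiplicity a), polarCoeff q a k *
      ∑ w ∈ fiber P t, (val (ratDeriv P) w)⁻¹ * ((w - a) ^ k)⁻¹ := by
    refine IsRat.sum _ fun k hk => (IsRat.const _).mul ?_
    obtain ⟨j, rfl⟩ := Nat.exists_eq_add_of_le' (Finset.mem_Icc.1 hk).1
    exact isRat_fiber_pow_inv hP a j
  refine h1.congr ?_
  filter_upwards [eventually_isGenericValue hP, (finite_singleton (val P a)).compl_mem_cofinite]
    with t ht hta
  simp only [Finset.mul_sum]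
  rw [Finset.sum_comm]
  refine Finset.sum_congr rfl fun w hw => ?_
  have hwa : w ≠ a := by rintro rfl; exact hta (ht.val_eq hw).symm
  rw [val_principalPart q hwa, Finset.mul_sum]
  exact Finset.sum_congr rfl fun k _ => by ring

theorem isRat_fiber_val (hP : 0 < degree P) (q : RatFunc ℂ) :
    IsRat fun t => ∑ w ∈ fiber P t, (val (ratDeriv P) w)⁻¹ * val q w := by
  obtain ⟨p, hp⟩ := exists_eq_polynomial_add_principalPart q
  have h1 := (IsRat.sum p.support fun k _ => (IsRat.const (p.coeff k)).mul
    (isRat_fiber_pow hP k)).add (IsRat.sum (finitePoles q) fun a _ =>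
      isRat_fiber_principalPart hP q a)
  refine h1.congr ?_
  filter_upwards [eventually_isGenericValue hP, eventually_reg_fiber P q] with t ht hq
  simp only [Finset.mul_sum]
  rw [Finset.sum_comm, Finset.sum_comm (s := finitePoles q), ← Finset.sum_add_distrib]
  refine Finset.sum_congr rfl fun w hw => ?_
  rw [val_eq_polynomial_add hp (reg_iff_notMem_finitePoles.1 (hq ht w hw)), mul_add,
    Finset.mul_sum, Polynomial.eval_eq_sum, Polynomial.sum_def, Finset.mul_sum]
  exact congrArg (· + _) (Finset.sum_congr rfl fun k _ => by ring)

end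

section

/-! ### The integral as a function on the sphere -/

variable {P q : RatFunc ℂ} {γ : ℝ → ℂ} {f φ : ℂ → ℂ}

/-- Differentiation under the integral sign. If the ball of radius `r` about `t₀` misses the values
of `φ`, then `|φ - t| ≥ r/2` on the half ball, which gives an integrable bound uniform in `t`. -/
theorem IsClosedCurve.differentiableAt_curveInt_div (hγ : IsClosedCurve γ)
    (hf : ContinuousOn f (γ '' Icc 0 1)) (hφ : ContinuousOn φ (γ '' Icc 0 1)) {t₀ : ℂ}
    (ht₀ : ∀ z ∈ γ '' Icc 0 1, φ z ≠ t₀) :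
    DifferentiableAt ℂ (fun t => curveInt γ (fun z => f z / (φ z - t))) t₀ := by
  obtain ⟨r, hr, hball⟩ := Metric.isOpen_iff.1
    (hγ.isCompact_trace.image_of_continuousOn hφ).isClosed.isOpen_compl t₀
    (by rintro ⟨z, hz, h⟩; exact ht₀ z hz h)
  have hfar : ∀ z ∈ γ '' Icc 0 1, ∀ t ∈ Metric.ball t₀ (r / 2), r / 2 ≤ ‖φ z - t‖ := by
    intro z hz t ht
    have h1 : r ≤ ‖φ z - t₀‖ := by
      rw [← dist_eq_norm]
      exact not_lt.1 fun h => hball (Metric.mem_ball.2 h) (mem_image_of_mem φ hz)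
    rw [Metric.mem_ball, dist_eq_norm] at ht
    have h2 : ‖φ z - t₀‖ ≤ ‖φ z - t‖ + ‖t - t₀‖ := by
      simpa using norm_add_le (φ z - t) (t - t₀)
    linarith
  have hne : ∀ z ∈ γ '' Icc 0 1, ∀ t ∈ Metric.ball t₀ (r / 2), φ z - t ≠ 0 := fun z hz t ht =>
    norm_pos_iff.1 ((half_pos hr).trans_le (hfar z hz t ht))
  have hcont : ∀ t ∈ Metric.ball t₀ (r / 2), ∀ k : ℕ,
      ContinuousOn (fun z => f z / (φ z - t) ^ k) (γ '' Icc 0 1) := fun t ht k =>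
    hf.div ((hφ.sub continuousOn_const).pow k) fun z hz => pow_ne_zero _ (hne z hz t ht)
  have hint : ∀ t ∈ Metric.ball t₀ (r / 2), ∀ k : ℕ, IntervalIntegrable
      (fun s => f (γ s) / (φ (γ s) - t) ^ k * deriv γ s) volume 0 1 := fun t ht k =>
    hγ.intervalIntegrable (hcont t ht k)
  have hmem : Metric.ball t₀ (r / 2) ∈ 𝓝 t₀ := Metric.ball_mem_nhds _ (half_pos hr)
  have hs : ∀ s ∈ uIoc (0 : ℝ) 1, γ s ∈ γ '' Icc 0 1 := fun s hs => by
    rw [uIoc_of_le zero_le_one] at hs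
    exact mem_image_of_mem γ (Ioc_subset_Icc_self hs)
  have h0 := Metric.mem_ball_self (x := t₀) (half_pos hr)
  refine (intervalIntegral.hasDerivAt_integral_of_dominated_loc_of_deriv_le
    (μ := volume) (a := 0) (b := 1) (x₀ := t₀)
    (F := fun t s => f (γ s) / (φ (γ s) - t) * deriv γ s)
    (F' := fun t s => f (γ s) / (φ (γ s) - t) ^ 2 * deriv γ s)
    (bound := fun s => ((r / 2) ^ 2)⁻¹ * ‖f (γ s) * deriv γ s‖)
    hmem ?_ ?_ ?_ ?_ ?_ ?_).2.differentiableAt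
  · filter_upwards [hmem] with t ht
    have := (hint t ht 1).aestronglyMeasurable_restrict_uIoc
    simpa only [pow_one] using this
  · simpa only [pow_one] using hint t₀ h0 1
  · exact (hint t₀ h0 2).aestronglyMeasurable_restrict_uIoc
  · refine Eventually.of_forall fun s hs' t ht => ?_
    rw [div_eq_mul_inv, mul_right_comm, norm_mul, norm_inv, norm_pow, mul_comm]
    gcongr
    exact hfar _ (hs s hs') t ht
  · exact (hγ.intervalIntegrable hf).norm.const_mul _
  · refine Eventually.of_forall fun s hs' t ht => ?_
    have h1 : HasDerivAt (fun t => φ (γ s) - t) (-1) t := by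
      simpa using (hasDerivAt_id t).const_sub (φ (γ s))
    have h2 := ((h1.inv (hne _ (hs s hs') t ht)).const_mul (f (γ s))).mul_const (deriv γ s)
    convert! h2 using 1
    rw [neg_neg, mul_one_div]

theorem IsClosedCurve.tendsto_curveInt_div (hγ : IsClosedCurve γ)
    (hf : ContinuousOn f (γ '' Icc 0 1)) (hφ : ContinuousOn φ (γ '' Icc 0 1)) :
    Tendsto (fun t => curveInt γ (fun z => f z / (φ z - t))) (Bornology.cobounded ℂ) (𝓝 0) := by
  obtain ⟨M, hM⟩ := (hγ.isCompact_trace.image_of_continuousOn hφ).isBounded.subset_closedBall 0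
  have hnorm : Tendsto (fun t : ℂ => ‖t‖ - M) (Bornology.cobounded ℂ) atTop :=
    tendsto_atTop_add_const_right _ _ tendsto_norm_cobounded_atTop
  have hlim : Tendsto (fun t : ℂ => (‖t‖ - M)⁻¹ * ∫ s in (0 : ℝ)..1, ‖f (γ s) * deriv γ s‖)
      (Bornology.cobounded ℂ) (𝓝 0) := by
    simpa using (tendsto_inv_atTop_zero.comp hnorm).mul_const _
  refine squeeze_zero_norm' ?_ hlim
  filter_upwards [hnorm.eventually_gt_atTop 0] with t ht
  rw [← intervalIntegral.integral_const_mul]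
  refine intervalIntegral.norm_integral_le_of_norm_le zero_le_one
    (Eventually.of_forall fun s hs => ?_) ((hγ.intervalIntegrable hf).norm.const_mul _)
  simp only
  rw [div_eq_mul_inv, mul_right_comm, norm_mul, norm_inv, mul_comm]
  have h1 : ‖φ (γ s)‖ ≤ M := by
    simpa using hM (mem_image_of_mem φ (mem_image_of_mem γ (Ioc_subset_Icc_self hs)))
  have h2 : ‖t‖ - ‖φ (γ s)‖ ≤ ‖φ (γ s) - t‖ := by
    rw [norm_sub_rev]; exact norm_sub_norm_le _ _
  gcongr
  linarith

theorem IFun_infty (q P : RatFunc ℂ) (γ : ℝ → ℂ) : IFun q P γ ∞ = 0 := rfl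

theorem image_sphereVal_eq (hPγ : ∀ z ∈ γ '' Icc 0 1, Reg P z) :
    (fun s => sphereVal P (γ s : OnePoint ℂ)) '' Icc (0 : ℝ) 1
      = ((↑) : ℂ → OnePoint ℂ) '' (val P '' (γ '' Icc 0 1)) := by
  simp only [image_image]
  exact image_congr fun s hs => sphereVal_of_reg (hPγ _ (mem_image_of_mem γ hs))

theorem coe_notMem_image_iff (hPγ : ∀ z ∈ γ '' Icc 0 1, Reg P z) {t : ℂ} :
    (t : OnePoint ℂ) ∉ (fun s => sphereVal P (γ s : OnePoint ℂ)) '' Icc (0 : ℝ) 1 ↔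
      ∀ z ∈ γ '' Icc 0 1, val P z ≠ t := by
  rw [image_sphereVal_eq hPγ, OnePoint.coe_injective.mem_set_image]
  simp only [mem_image, not_exists, not_and, ne_eq]

theorem continuousOn_val_trace (hPγ : ∀ z ∈ γ '' Icc 0 1, Reg P z) :
    ContinuousOn (val P) (γ '' Icc 0 1) := fun z hz =>
  (continuousAt_val (hPγ z hz)).continuousWithinAt

theorem IsClosedCurve.isOpen_compl_image (hγ : IsClosedCurve γ)
    (hPγ : ∀ z ∈ γ '' Icc 0 1, Reg P z) :
    IsOpen ((fun s => sphereVal P (γ s : OnePoint ℂ)) '' Icc (0 : ℝ) 1)ᶜ := by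
  rw [image_sphereVal_eq hPγ]
  exact ((hγ.isCompact_trace.image_of_continuousOn (continuousOn_val_trace hPγ)).image
    OnePoint.continuous_coe).isClosed.isOpen_compl

theorem infty_notMem_image (hPγ : ∀ z ∈ γ '' Icc 0 1, Reg P z) :
    ∞ ∉ (fun s => sphereVal P (γ s : OnePoint ℂ)) '' Icc (0 : ℝ) 1 := by
  rw [image_sphereVal_eq hPγ]
  exact OnePoint.infty_notMem_image_coe

theorem IsClosedCurve.differentiableAt_IFun (hγ : IsClosedCurve γ)
    (hPγ : ∀ z ∈ γ '' Icc 0 1, Reg P z) (hqγ : ∀ z ∈ γ '' Icc 0 1, Reg q z) {t : ℂ}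
    (ht : ∀ z ∈ γ '' Icc 0 1, val P z ≠ t) :
    DifferentiableAt ℂ (fun t : ℂ => IFun q P γ t) t :=
  (hγ.differentiableAt_curveInt_div (continuousOn_val_trace hqγ) (continuousOn_val_trace hPγ)
    ht).const_mul _

theorem IsClosedCurve.analyticAt_IFun (hγ : IsClosedCurve γ)
    (hPγ : ∀ z ∈ γ '' Icc 0 1, Reg P z) (hqγ : ∀ z ∈ γ '' Icc 0 1, Reg q z) {t : ℂ}
    (ht : ∀ z ∈ γ '' Icc 0 1, val P z ≠ t) : AnalyticAt ℂ (fun t : ℂ => IFun q P γ t) t := by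
  rw [Complex.analyticAt_iff_eventually_differentiableAt]
  have := OnePoint.continuous_coe.continuousAt.eventually
    ((hγ.isOpen_compl_image hPγ).mem_nhds ((coe_notMem_image_iff hPγ).2 ht))
  filter_upwards [this] with w hw
  exact hγ.differentiableAt_IFun hPγ hqγ ((coe_notMem_image_iff hPγ).1 hw)

theorem IsClosedCurve.tendsto_IFun (hγ : IsClosedCurve γ)
    (hPγ : ∀ z ∈ γ '' Icc 0 1, Reg P z) (hqγ : ∀ z ∈ γ '' Icc 0 1, Reg q z) :
    Tendsto (fun t : ℂ => IFun q P γ t) (Bornology.cobounded ℂ) (𝓝 0) := by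
  have := (hγ.tendsto_curveInt_div (continuousOn_val_trace hqγ)
    (continuousOn_val_trace hPγ)).const_mul (2 * Real.pi * Complex.I : ℂ)⁻¹
  rwa [mul_zero] at this

theorem coclosedCompact_eq_cobounded : coclosedCompact ℂ = Bornology.cobounded ℂ := by
  rw [coclosedCompact_eq_cocompact, Metric.cobounded_eq_cocompact]

theorem tendsto_coe_cobounded :
    Tendsto ((↑) : ℂ → OnePoint ℂ) (Bornology.cobounded ℂ) (𝓝 ∞) := by
  rw [← coclosedCompact_eq_cobounded]; exact OnePoint.tendsto_coe_infty

/-- If the integral coincides with a rational function near infinity, it does so on the whole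
component of infinity. -/
theorem IsClosedCurve.eq_IFun_of_eventually_eq (hγ : IsClosedCurve γ)
    (hPγ : ∀ z ∈ γ '' Icc 0 1, Reg P z) (hqγ : ∀ z ∈ γ '' Icc 0 1, Reg q z) {R : RatFunc ℂ}
    (hR : ∀ᶠ t : ℂ in Bornology.cobounded ℂ, IFun q P γ t = val R t) :
    ∀ x ∈ UInf P γ, sphereVal R x = (IFun q P γ x : OnePoint ℂ) := by
  set Ω : Set (OnePoint ℂ) := ((fun s => sphereVal P (γ s : OnePoint ℂ)) '' Icc (0 : ℝ) 1)ᶜ with hΩ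
  have hΩo : IsOpen Ω := hγ.isOpen_compl_image hPγ
  set A : Set (OnePoint ℂ) := {x | ∀ᶠ y in 𝓝 x, sphereVal R y = (IFun q P γ y : OnePoint ℂ)} with hA
  have hAo : IsOpen A := isOpen_setOfPred_eventually_nhds
  have hinf : ∞ ∈ A := by
    have h1 : ∀ᶠ t : ℂ in Bornology.cobounded ℂ,
        sphereVal R t = (IFun q P γ (t : OnePoint ℂ) : OnePoint ℂ) := by
      filter_upwards [hR, eventually_cobounded_of_cofinite (reg_eventually R)] with t h1 h2
      rw [sphereVal_of_reg h2, h1]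
    have h2 : sphereVal R ∞ = ((0 : ℂ) : OnePoint ℂ) :=
      tendsto_nhds_unique_of_eventuallyEq
        (((continuous_sphereVal R).tendsto ∞).comp tendsto_coe_cobounded)
        ((OnePoint.continuous_coe.tendsto 0).comp (hγ.tendsto_IFun hPγ hqγ)) h1
    simp only [hA, mem_ofPred_eq, OnePoint.nhds_infty_eq, coclosedCompact_eq_cobounded,
      eventually_sup, eventually_map, eventually_pure]
    exact ⟨h1, by rw [h2, IFun_infty]⟩
  -- `A` is also closed in `Ω`: at a finite point outside `A`, agreement with `R` cannot accumulate.
  have hBo : IsOpen (Ω \ A) := by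
    rw [isOpen_iff_mem_nhds]
    rintro x ⟨hxΩ, hxA⟩
    refine inter_mem (hΩo.mem_nhds hxΩ) ?_
    induction x using OnePoint.rec with
    | infty => exact absurd hinf hxA
    | coe t₀ =>
      have ht₀ := (coe_notMem_image_iff hPγ).1 hxΩ
      have han := hγ.analyticAt_IFun hPγ hqγ ht₀
      have hnot : ¬ ∃ᶠ t in 𝓝[≠] t₀,
          sphereVal R (t : ℂ) = (IFun q P γ (t : OnePoint ℂ) : OnePoint ℂ) := by
        intro hfreq
        -- By continuity on the sphere the equality passes to `t₀`, so `t₀` is not a pole of `R` and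
        -- the identity theorem for analytic functions applies.
        have heq : sphereVal R t₀ = (IFun q P γ (t₀ : OnePoint ℂ) : OnePoint ℂ) := by
          have hc1 : ContinuousAt (fun t : ℂ => sphereVal R t) t₀ :=
            ((continuous_sphereVal R).comp OnePoint.continuous_coe).continuousAt
          have hc2 : ContinuousAt (fun t : ℂ => (IFun q P γ (t : OnePoint ℂ) : OnePoint ℂ)) t₀ :=
            OnePoint.continuous_coe.continuousAt.comp han.continuousAt
          exact tendsto_nhds_unique_of_frequently_eq hc1 hc2 (hfreq.filter_mono nhdsWithin_le_nhds)
        have hreg : Reg R t₀ := reg_iff.2 (by rw [heq]; exact OnePoint.coe_ne_infty _)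
        have hregn : ∀ᶠ t in 𝓝 t₀, Reg R t := (isOpen_reg R).mem_nhds hreg
        have h1 : ∃ᶠ t in 𝓝[≠] t₀, val R t = IFun q P γ (t : ℂ) :=
          (hfreq.and_eventually (hregn.filter_mono nhdsWithin_le_nhds)).mono fun t ht => by
            have := ht.1
            rw [sphereVal_of_reg ht.2] at this
            exact OnePoint.coe_injective this
        have h2 := ((analyticAt_val hreg).frequently_eq_iff_eventually_eq han).1 h1
        refine hxA ?_
        simp only [hA, mem_ofPred_eq, OnePoint.nhds_coe_eq, eventually_map]
        filter_upwards [h2, hregn] with t h3 h4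
        rw [sphereVal_of_reg h4, h3]
      rw [not_frequently, eventually_nhdsWithin_iff] at hnot
      have hcompl : ∀ᶠ y in 𝓝 (t₀ : OnePoint ℂ), y ∉ A := by
        rw [OnePoint.nhds_coe_eq, eventually_map]
        filter_upwards [hnot] with t ht
        rcases eq_or_ne t t₀ with rfl | hne
        · exact hxA
        · exact fun h => ht hne h.self_of_nhds
      exact hcompl
  have hsub : UInf P γ ⊆ A := by
    refine isPreconnected_connectedComponentIn.subset_left_of_subset_union hAo hBo
      disjoint_sdiff_right ?_ ⟨∞, mem_connectedComponentIn (infty_notMem_image hPγ), hinf⟩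
    rw [union_sdiff_self]
    exact (connectedComponentIn_subset _ _).trans subset_union_right
  exact fun x hx => (hsub hx).self_of_nhds

/-- The preimages of `t` are near the poles of `P` when `t` is large. -/
theorem eventually_preimage_mem (P : RatFunc ℂ) {S : Set (OnePoint ℂ)}
    (hS : ∀ x, sphereVal P x = ∞ → S ∈ 𝓝 x) :
    ∀ᶠ t : ℂ in Bornology.cobounded ℂ, ∀ x, sphereVal P x = (t : OnePoint ℂ) → x ∈ S := by
  -- The image of the compact complement of `interior S` is closed and misses `∞`, hence misses all
  -- large `t`.
  have hc : IsCompact (sphereVal P '' (interior S)ᶜ) :=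
    isOpen_interior.isClosed_compl.isCompact.image (continuous_sphereVal P)
  have hinf : (sphereVal P '' (interior S)ᶜ)ᶜ ∈ 𝓝 (∞ : OnePoint ℂ) := by
    refine hc.isClosed.isOpen_compl.mem_nhds ?_
    rintro ⟨x, hx, h⟩
    exact hx (mem_interior_iff_mem_nhds.2 (hS x h))
  filter_upwards [tendsto_coe_cobounded hinf] with t ht x hx
  by_contra hxS
  exact ht ⟨x, fun h => hxS (interior_subset h), hx⟩

theorem IsClosedCurve.eventually_winding_fiber (hγ : IsClosedCurve γ)
    (hγP : ∀ s ∈ Icc (0 : ℝ) 1, (γ s : OnePoint ℂ) ∉ poles P) {c : ℂ}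
    (hc : ∀ x ∈ poles P, winding γ x = c) :
    ∀ᶠ t : ℂ in Bornology.cobounded ℂ, ∀ x, sphereVal P x = (t : OnePoint ℂ) → winding γ x = c := by
  refine eventually_preimage_mem P (S := {x | winding γ x = c}) fun x hx => ?_
  have := hγ.winding_eventually_eq_sphere (x := x) fun s hs h => hγP s hs (by rw [h]; exact hx)
  filter_upwards [this] with y hy
  rw [hy, hc x hx]

theorem reg_of_notMem_poles (h : ∀ s ∈ Icc (0 : ℝ) 1, (γ s : OnePoint ℂ) ∉ poles P) :
    ∀ z ∈ γ '' Icc 0 1, Reg P z := by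
  rintro _ ⟨s, hs, rfl⟩
  exact reg_iff.2 (h s hs)

/-- The integral near infinity when all the poles of `P` have the same winding number. -/
theorem IsClosedCurve.eventually_IFun_eq (hγ : IsClosedCurve γ) (hP : 0 < degree P)
    (hγP : ∀ s ∈ Icc (0 : ℝ) 1, (γ s : OnePoint ℂ) ∉ poles P)
    (hγq : ∀ s ∈ Icc (0 : ℝ) 1, (γ s : OnePoint ℂ) ∉ poles q) {c : ℂ}
    (hc : ∀ x ∈ poles P, winding γ x = c) :
    ∀ᶠ t : ℂ in Bornology.cobounded ℂ, IFun q P γ t =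
      c * ∑ w ∈ fiber P t, (val (ratDeriv P) w)⁻¹ * val q w
      - ∑ a ∈ finitePoles q, winding γ (a : OnePoint ℂ) *
          ∑ w ∈ fiber P t, (val (ratDeriv P) w)⁻¹ * val (principalPart q a) w
      + (2 * Real.pi * Complex.I)⁻¹ * recipAtInfty P t * curveInt γ (val q) := by
  have hPγ := reg_of_notMem_poles hγP
  have hPt : ∀ᶠ t : ℂ in Bornology.cobounded ℂ,
      (t : OnePoint ℂ) ∈ ((fun s => sphereVal P (γ s : OnePoint ℂ)) '' Icc (0 : ℝ) 1)ᶜ :=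
    tendsto_coe_cobounded ((hγ.isOpen_compl_image hPγ).mem_nhds (infty_notMem_image hPγ))
  filter_upwards [eventually_cobounded_of_cofinite (eventually_isGenericValue hP),
    eventually_cobounded_of_cofinite (eventually_reg_fiber P q),
    hγ.eventually_winding_fiber hγP hc, hPt] with t h1 h2 h3 h4
  rw [hγ.IFun_eq hPγ (reg_of_notMem_poles hγq) h1 (h2 h1) ((coe_notMem_image_iff hPγ).1 h4)]
  congr 1
  simp only [Finset.mul_sum]
  rw [Finset.sum_comm, ← Finset.sum_sub_distrib]
  refine Finset.sum_congr rfl fun w hw => ?_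
  rw [h3 w (h1.mem_fiber_iff.1 hw), mul_sub, Finset.mul_sum]
  congr 1
  · ring
  · exact Finset.sum_congr rfl fun a _ => by ring

theorem IsClosedCurve.exists_ratFunc_eq_IFun (hγ : IsClosedCurve γ) (hP : 0 < degree P)
    (hγP : ∀ s ∈ Icc (0 : ℝ) 1, (γ s : OnePoint ℂ) ∉ poles P)
    (hγq : ∀ s ∈ Icc (0 : ℝ) 1, (γ s : OnePoint ℂ) ∉ poles q) (hside : OnOneSide γ (poles P)) :
    ∃ R : RatFunc ℂ, ∀ x ∈ UInf P γ, sphereVal R x = (IFun q P γ x : OnePoint ℂ) := by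
  obtain ⟨c, hc⟩ : ∃ c, ∀ x ∈ poles P, winding γ x = c := by
    rcases (poles P).eq_empty_or_nonempty with h | ⟨y, hy⟩
    · exact ⟨0, by simp [h]⟩
    · exact ⟨winding γ y, fun x hx => hside x hx y hy⟩
  obtain ⟨R, hR⟩ : IsRat fun t => c * ∑ w ∈ fiber P t, (val (ratDeriv P) w)⁻¹ * val q w
      - ∑ a ∈ finitePoles q, winding γ (a : OnePoint ℂ) *
          ∑ w ∈ fiber P t, (val (ratDeriv P) w)⁻¹ * val (principalPart q a) w
      + (2 * Real.pi * Complex.I)⁻¹ * recipAtInfty P t * curveInt γ (val q) :=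
    (((IsRat.const c).mul (isRat_fiber_val hP q)).sub (IsRat.sum _ fun a _ =>
      (IsRat.const _).mul (isRat_fiber_principalPart hP q a))).add
      (((IsRat.const _).mul (isRat_recipAtInfty hP)).mul (IsRat.const _))
  refine ⟨R, hγ.eq_IFun_of_eventually_eq (reg_of_notMem_poles hγP) (reg_of_notMem_poles hγq) ?_⟩
  filter_upwards [hγ.eventually_IFun_eq hP hγP hγq hc, eventually_cobounded_of_cofinite hR]
    with t h1 h2
  rw [h1, h2]

/-- With `c = 0` the fibre sums drop out near `∞`, and `∫ q` vanishes because no residue of `q` is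
enclosed; the comparison function is `R = 0`. -/
theorem IsClosedCurve.IFun_eq_zero (hγ : IsClosedCurve γ) (hP : 0 < degree P)
    (hγP : ∀ s ∈ Icc (0 : ℝ) 1, (γ s : OnePoint ℂ) ∉ poles P)
    (hγq : ∀ s ∈ Icc (0 : ℝ) 1, (γ s : OnePoint ℂ) ∉ poles q)
    (hout : LieOutside γ (poles P ∪ poles q)) : ∀ x ∈ UInf P γ, IFun q P γ x = 0 := by
  have hqγ := reg_of_notMem_poles hγq
  have hq : ∀ a ∈ finitePoles q, winding γ (a : OnePoint ℂ) = 0 := fun a ha =>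
    hout a (Or.inr (sphereVal_of_not_reg fun h => reg_iff_notMem_finitePoles.1 h ha))
  have h0 := hγ.eq_IFun_of_eventually_eq (R := 0) (reg_of_notMem_poles hγP) hqγ (by
    filter_upwards [hγ.eventually_IFun_eq hP hγP hγq fun x hx => hout x (Or.inl hx)] with t ht
    rw [ht, hγ.curveInt_val_eq_zero hqγ hq, Finset.sum_eq_zero (s := finitePoles q) fun a ha => by
      rw [hq a ha, zero_mul]]
    simp [val_def])
  intro x hx
  induction x using OnePoint.rec with
  | infty => rfl
  | coe t =>
    have := h0 t hx
    rw [sphereVal_of_reg (by simp [Reg])] at this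
    rw [← OnePoint.coe_injective this]
    simp [val_def]

end

section

/-! ### Sums over the branches of the inverse -/

variable {P q : RatFunc ℂ} {γ : ℝ → ℂ} {U : Set ℂ} {g : Fin (degree P) → ℂ → OnePoint ℂ}

theorem toC_coe (z : ℂ) : toC (z : OnePoint ℂ) = z := rfl

namespace IsBranches

variable {t : ℂ}

theorem ne_infty (hg : IsBranches P U g) (ht : t ∈ U) (h : IsGenericValue P t)
    (i : Fin (degree P)) : g i t ≠ ∞ := fun hi =>
  h.sphereVal_infty_ne (by rw [← hi]; exact hg.rightInv i t ht)

theorem exists_mem_fiber (hg : IsBranches P U g) (ht : t ∈ U) (h : IsGenericValue P t)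
    (i : Fin (degree P)) : ∃ z ∈ fiber P t, g i t = (z : OnePoint ℂ) := by
  obtain ⟨z, hz⟩ := OnePoint.ne_infty_iff_exists.1 (hg.ne_infty ht h i)
  refine ⟨z, h.mem_fiber_iff.2 ?_, hz.symm⟩
  rw [hz]; exact hg.rightInv i t ht

/-- The `n` distinct branch values lie in a fibre of exactly `n` points, so they exhaust it. None of
them is `∞`, so the default value of `toC` does not interfere. -/
theorem sum_eq (hg : IsBranches P U g) (ht : t ∈ U) (h : IsGenericValue P t)
    (F : ℂ → ℂ) : ∑ i, F (toC (g i t)) = ∑ w ∈ fiber P t, F w := by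
  choose z hz hgz using hg.exists_mem_fiber ht h
  have hinj : Function.Injective z := fun i j hij => hg.injective t ht (by
    simp only [hgz, hij])
  have himg : Finset.univ.map ⟨z, hinj⟩ = fiber P t := by
    refine Finset.eq_of_subset_of_card_le (fun w hw => ?_) ?_
    · obtain ⟨i, -, rfl⟩ := Finset.mem_map.1 hw
      exact hz i
    · rw [Finset.card_map, h.card_fiber, Finset.card_univ, Fintype.card_fin]
  rw [← himg, Finset.sum_map]
  exact Finset.sum_congr rfl fun i _ => by rw [hgz]; rfl

theorem reg_toC (hg : IsBranches P U g) (ht : t ∈ U) (h : IsGenericValue P t)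
    (hq : ∀ w ∈ fiber P t, Reg q w) (i : Fin (degree P)) : Reg (q / ratDeriv P) (toC (g i t)) := by
  obtain ⟨z, hz, hgz⟩ := hg.exists_mem_fiber ht h i
  rw [hgz, toC_coe]
  exact reg_div (hq z hz) (h.val_ratDeriv_ne_zero hz)

theorem toC_sphereVal (hg : IsBranches P U g) (ht : t ∈ U) (h : IsGenericValue P t)
    (hq : ∀ w ∈ fiber P t, Reg q w) (i : Fin (degree P)) :
    toC (sphereVal (q / ratDeriv P) (g i t))
      = (val (ratDeriv P) (toC (g i t)))⁻¹ * val q (toC (g i t)) := by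
  obtain ⟨z, hz, hgz⟩ := hg.exists_mem_fiber ht h i
  have hne := h.val_ratDeriv_ne_zero hz
  rw [hgz, sphereVal_of_reg (reg_div (hq z hz) hne), toC_coe, toC_coe, val_div (hq z hz) hne,
    div_eq_inv_mul]

theorem psi_eq (hg : IsBranches P U g) (ht : t ∈ U) (h : IsGenericValue P t) {a : ℂ}
    (ha : ∀ w ∈ fiber P t, w ≠ a) : psi P q g a t
      = ∑ w ∈ fiber P t, (val (ratDeriv P) w)⁻¹ * val (principalPart q a) w := by
  rw [psi, branchSum, ← hg.sum_eq ht h]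
  exact Finset.sum_congr rfl fun i _ =>
    hg.toC_sphereVal ht h (fun w hw => reg_principalPart q (ha w hw)) i

end IsBranches

theorem eventually_fiber_ne (P : RatFunc ℂ) (a : ℂ) :
    ∀ᶠ t : ℂ in cofinite, IsGenericValue P t → ∀ w ∈ fiber P t, w ≠ a := by
  filter_upwards [(finite_singleton (val P a)).compl_mem_cofinite] with t ht h w hw
  rintro rfl
  exact ht (h.val_eq hw).symm

theorem continuousAt_toC {x : OnePoint ℂ} (hx : x ≠ ∞) : ContinuousAt toC x := by
  obtain ⟨z, rfl⟩ := OnePoint.ne_infty_iff_exists.1 hx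
  rw [OnePoint.continuousAt_coe]
  exact continuousAt_id

/-- At generic `t` the branch sum is a fibre sum, known to be rational. At an exceptional point of
`U` with finite summands both sides are continuous into the sphere, and agreement on a punctured
neighbourhood decides. -/
theorem IsBranches.exists_ratFunc_eq_psi (hg : IsBranches P U g) (hP : 0 < degree P)
    (hU : IsOpen U) (q : RatFunc ℂ) (a : ℂ) : ∃ R : RatFunc ℂ, ∀ t ∈ U,
      (∀ i, sphereVal (principalPart q a / ratDeriv P) (g i t) ≠ ∞) →
      sphereVal R t = (psi P q g a t : OnePoint ℂ) := by
  obtain ⟨R, hR⟩ := isRat_fiber_principalPart hP q a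
  refine ⟨R, fun t₀ ht₀ hfin => ?_⟩
  have hgen : ∀ᶠ t in 𝓝[≠] t₀, sphereVal R (t : ℂ) = (psi P q g a t : OnePoint ℂ) := by
    have hcof : 𝓝[≠] t₀ ≤ cofinite :=
      le_cofinite_iff_compl_singleton_mem.2 fun s => by
        rcases eq_or_ne s t₀ with rfl | hs
        · exact self_mem_nhdsWithin
        · exact mem_nhdsWithin_of_mem_nhds (isOpen_ne.mem_nhds hs.symm)
    filter_upwards [hcof hR, hcof (reg_eventually R), hcof (eventually_isGenericValue hP),
      hcof (eventually_fiber_ne P a), mem_nhdsWithin_of_mem_nhds (hU.mem_nhds ht₀)]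
      with t h1 h2 h3 h4 h5
    rw [sphereVal_of_reg h2, hg.psi_eq h5 h3 (h4 h3), ← h1]
  have hc1 : ContinuousAt (fun t : ℂ => sphereVal R t) t₀ :=
    ((continuous_sphereVal R).comp OnePoint.continuous_coe).continuousAt
  have hc2 : ContinuousAt (fun t : ℂ => (psi P q g a t : OnePoint ℂ)) t₀ := by
    have hi : ∀ i, ContinuousAt (fun t => sphereVal (principalPart q a / ratDeriv P) (g i t)) t₀ :=
      fun i => (continuous_sphereVal _).continuousAt.comp
        ((hg.continuousOn i).continuousAt (hU.mem_nhds ht₀))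
    have h : ContinuousAt (fun t => psi P q g a t) t₀ := by
      unfold psi branchSum ContinuousAt
      exact tendsto_finsetSum _ fun i _ => (continuousAt_toC (hfin i)).tendsto.comp (hi i)
    exact OnePoint.continuous_coe.continuousAt.comp h
  exact tendsto_nhds_unique_of_eventuallyEq (hc1.tendsto.mono_left nhdsWithin_le_nhds)
    (hc2.tendsto.mono_left nhdsWithin_le_nhds) hgen

/-! ### The ends of the branches -/

/-- This makes limits along `t → ∞` in `U` unique, hence the sets `J_e` disjoint. -/
theorem neBot_cobounded_inf_principal
    (hU : (∞ : OnePoint ℂ) ∈ closure ((fun t : ℂ => (t : OnePoint ℂ)) '' U)) :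
    (Bornology.cobounded ℂ ⊓ 𝓟 U).NeBot := by
  rw [inf_principal_neBot_iff]
  intro s hs
  have h1 : ((↑) : ℂ → OnePoint ℂ) '' s ∪ {∞} ∈ 𝓝 (∞ : OnePoint ℂ) := by
    rw [OnePoint.nhds_infty_eq, coclosedCompact_eq_cobounded]
    refine mem_sup.2 ⟨?_, by simp⟩
    exact mem_map.2 (mem_of_superset hs fun t ht => Or.inl ⟨t, ht, rfl⟩)
  obtain ⟨x, hx1, t, ht, rfl⟩ := mem_closure_iff_nhds.1 hU _ h1
  rcases hx1 with ⟨t', ht', h⟩ | h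
  · exact ⟨t, by rwa [← OnePoint.coe_injective h], ht⟩
  · exact absurd h (OnePoint.coe_ne_infty t)

theorem mem_branchesNear {n : ℕ} {g : Fin n → ℂ → OnePoint ℂ} {e : OnePoint ℂ} {i : Fin n} :
    i ∈ branchesNear U g e ↔ Tendsto (g i) (Bornology.cobounded ℂ ⊓ 𝓟 U) (𝓝 e) := by
  simp [branchesNear]

theorem mem_polesFinset {e : OnePoint ℂ} : e ∈ polesFinset P ↔ sphereVal P e = ∞ := by
  simp [polesFinset, poles]

/-- A branch over a domain with one end at infinity tends to a pole of `P`. -/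
theorem IsBranches.exists_tendsto (hg : IsBranches P U g)
    (hconn : ∃ᶠ R : ℝ in atTop, IsConnected (U ∩ {t | R < ‖t‖})) (i : Fin (degree P)) :
    ∃ e, sphereVal P e = ∞ ∧ Tendsto (g i) (Bornology.cobounded ℂ ⊓ 𝓟 U) (𝓝 e) := by
  obtain ⟨V, hV, hdisj⟩ := (poles_finite P).t2_separation
  have hfilter : ∀ {p : ℂ → Prop}, (∀ᶠ t in Bornology.cobounded ℂ, p t) →
      ∃ R₀ : ℝ, ∀ t, R₀ < ‖t‖ → p t := fun {p} hp => by
    rw [← comap_norm_atTop, eventually_comap] at hp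
    obtain ⟨R₀, hR₀⟩ := eventually_atTop.1 hp
    exact ⟨R₀, fun t ht => hR₀ _ ht.le t rfl⟩
  -- far from the origin the branch stays near one pole
  have hstay : ∀ W : OnePoint ℂ → Set (OnePoint ℂ), (∀ x, x ∈ W x ∧ IsOpen (W x)) →
      (∀ x, W x ⊆ V x) → ∃ R, IsConnected (U ∩ {t | R < ‖t‖}) ∧
        ∃ e ∈ poles P, ∀ t ∈ U ∩ {t | R < ‖t‖}, g i t ∈ W e := by
    intro W hW hWV
    obtain ⟨R₀, hR₀⟩ := hfilter (eventually_preimage_mem P (S := ⋃ e ∈ poles P, W e)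
      fun x hx => mem_of_superset ((hW x).2.mem_nhds (hW x).1) (subset_biUnion_of_mem (u := W) hx))
    obtain ⟨R, hR, hRR₀⟩ := (hconn.and_eventually (eventually_ge_atTop R₀)).exists
    have hsub : g i '' (U ∩ {t | R < ‖t‖}) ⊆ ⋃ e ∈ poles P, W e := by
      rintro _ ⟨t, ht, rfl⟩
      exact hR₀ t (hRR₀.trans_lt ht.2) _ (hg.rightInv i t ht.1)
    have hpre : IsConnected (g i '' (U ∩ {t | R < ‖t‖})) :=
      hR.image _ ((hg.continuousOn i).mono inter_subset_left)
    obtain ⟨x, hx⟩ := hpre.nonempty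
    obtain ⟨e, he, hxe⟩ := mem_iUnion₂.1 (hsub hx)
    refine ⟨R, hR, e, he, fun t ht => ?_⟩
    refine hpre.isPreconnected.subset_left_of_subset_union (hW e).2
      (isOpen_biUnion (s := poles P \ {e}) (f := W) fun e' _ => (hW e').2) ?_ ?_ ⟨x, hx, hxe⟩
      (mem_image_of_mem _ ht)
    · rw [disjoint_iUnion₂_right]
      intro e' he'
      exact (hdisj he he'.1 (fun h => he'.2 h.symm)).mono (hWV e) (hWV e')
    · intro y hy
      obtain ⟨e', he', hy'⟩ := mem_iUnion₂.1 (hsub hy)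
      rcases eq_or_ne e' e with rfl | hne
      · exact Or.inl hy'
      · exact Or.inr (mem_iUnion₂.2 ⟨e', ⟨he', hne⟩, hy'⟩)
  obtain ⟨R, -, e, he, hRe⟩ := hstay V hV fun _ => subset_rfl
  refine ⟨e, he, fun N hN => ?_⟩
  obtain ⟨N', hN'N, hN'o, heN'⟩ := mem_nhds_iff.1 hN
  classical
  -- Only the neighbourhood of `e` is shrunk, to fit inside `N'`; the others are kept, so
  -- disjointness can still identify `e'` with `e`.
  obtain ⟨R', hR', e', he', hRe'⟩ := hstay (fun x => if x = e then V x ∩ N' else V x)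
    (fun x => by
      split_ifs with h
      · exact ⟨⟨(hV x).1, by rwa [h]⟩, (hV x).2.inter hN'o⟩
      · exact hV x)
    (fun x => by
      split_ifs with h
      · exact inter_subset_left
      · exact subset_rfl)
  -- the connected tails are nested, so the pole does not depend on the tail
  obtain ⟨R₁, hR₁, hle⟩ := (hconn.and_eventually (eventually_ge_atTop (max R R'))).exists
  obtain ⟨t, htU, ht⟩ := hR₁.nonempty
  have ht1 : t ∈ U ∩ {t | R < ‖t‖} := ⟨htU, ((le_max_left _ _).trans hle).trans_lt ht⟩
  have ht2 : t ∈ U ∩ {t | R' < ‖t‖} := ⟨htU, ((le_max_right _ _).trans hle).trans_lt ht⟩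
  have hee : e' = e := by
    by_contra hne
    have h1 := hRe' t ht2
    rw [if_neg hne] at h1
    exact disjoint_left.1 (hdisj he' he hne) h1 (hRe t ht1)
  subst hee
  rw [mem_map, mem_inf_principal]
  have hfar : ∀ᶠ t : ℂ in Bornology.cobounded ℂ, R' < ‖t‖ :=
    tendsto_norm_cobounded_atTop.eventually_gt_atTop R'
  filter_upwards [hfar] with t ht htU
  have h1 := hRe' t ⟨htU, ht⟩
  rw [if_pos rfl] at h1
  exact hN'N h1.2

/-- The formula for the integral near infinity in terms of the branches. -/
theorem IsBranches.eventually_IFun_eq (hg : IsBranches P U g) (hP : 0 < degree P)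
    (hγ : IsClosedCurve γ)
    (hγP : ∀ s ∈ Icc (0 : ℝ) 1, (γ s : OnePoint ℂ) ∉ poles P)
    (hγq : ∀ s ∈ Icc (0 : ℝ) 1, (γ s : OnePoint ℂ) ∉ poles q)
    [(Bornology.cobounded ℂ ⊓ 𝓟 U).NeBot]
    (hends : ∀ i, ∃ e ∈ polesFinset P, i ∈ branchesNear U g e) :
    ∀ᶠ t : ℂ in Bornology.cobounded ℂ, t ∈ U → (t : OnePoint ℂ) ∈ UInf P γ →
      (∀ i, g i t ≠ ∞ ∧ sphereVal (q / ratDeriv P) (g i t) ≠ ∞ ∧ ∀ z ∈ finitePoles q,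
        sphereVal (principalPart q z / ratDeriv P) (g i t) ≠ ∞) ∧
      sphereVal P ∞ ≠ (t : OnePoint ℂ) ∧
      IFun q P γ t = ∑ e ∈ polesFinset P, winding γ e * branchSum P q g (branchesNear U g e) t
        - ∑ z ∈ finitePoles q, winding γ (z : OnePoint ℂ) * psi P q g z t
        + (2 * Real.pi * Complex.I)⁻¹ * recipAtInfty P t * curveInt γ (val q) := by
  have hPγ := reg_of_notMem_poles hγP
  choose e he hie using hends
  have huniq : ∀ i e', i ∈ branchesNear U g e' → e' = e i := fun i e' h =>
    tendsto_nhds_unique (mem_branchesNear.1 h) (mem_branchesNear.1 (hie i))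
  -- A branch converges to a pole off `γ`, and the winding number is locally constant there, also at
  -- `∞`.
  have hwind : ∀ᶠ t : ℂ in Bornology.cobounded ℂ, t ∈ U →
      ∀ i, winding γ (g i t) = winding γ (e i) := by
    rw [← eventually_inf_principal, eventually_all]
    exact fun i => (mem_branchesNear.1 (hie i)).eventually (hγ.winding_eventually_eq_sphere
      fun s hs h => hγP s hs (by rw [h]; exact mem_polesFinset.1 (he i)))
  filter_upwards [eventually_cobounded_of_cofinite (eventually_isGenericValue hP),
    eventually_cobounded_of_cofinite (eventually_reg_fiber P q), hwind] with t h1 h2 h3 htU htinf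
  have hPt := (coe_notMem_image_iff hPγ).1 (connectedComponentIn_subset _ _ htinf)
  have hqt := h2 h1
  have hne : ∀ a ∈ finitePoles q, ∀ w ∈ fiber P t, w ≠ a := fun a ha w hw hwa =>
    reg_iff_notMem_finitePoles.1 (hqt w hw) (by rwa [hwa])
  have hfinite : ∀ {r : RatFunc ℂ}, (∀ w ∈ fiber P t, Reg r w) → ∀ i,
      sphereVal (r / ratDeriv P) (g i t) ≠ ∞ := fun hr i => by
    have hreg := hg.reg_toC htU h1 hr i
    obtain ⟨z, -, hz⟩ := hg.exists_mem_fiber htU h1 i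
    rw [hz, toC_coe] at hreg
    rw [hz]
    exact reg_iff.1 hreg
  refine ⟨fun i => ⟨hg.ne_infty htU h1 i, hfinite hqt i, fun a ha =>
    hfinite (fun w hw => reg_principalPart q (hne a ha w hw)) i⟩, h1.sphereVal_infty_ne, ?_⟩
  have hmain : ∑ e ∈ polesFinset P, winding γ e * branchSum P q g (branchesNear U g e) t
      = ∑ w ∈ fiber P t, winding γ w * ((val (ratDeriv P) w)⁻¹ * val q w) := by
    classical
    -- As `J_{e'} = {i | e i = e'}`, each inner sum becomes an indicator sum over all branches;
    -- exchanging the sums leaves the single pole `e i` for each `i`.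
    have hJ : ∀ e' ∈ polesFinset P,
        winding γ e' * branchSum P q g (branchesNear U g e') t = ∑ i, if e' = e i then
          winding γ (e i) * toC (sphereVal (q / ratDeriv P) (g i t)) else 0 := by
      intro e' _
      rw [← Finset.sum_filter, branchSum, Finset.mul_sum]
      refine Finset.sum_congr ?_ fun i hi => ?_
      · ext i
        simp only [Finset.mem_filter, Finset.mem_univ, true_and]
        exact ⟨huniq i e', fun h => h ▸ hie i⟩
      · rw [← (Finset.mem_filter.1 hi).2]
    rw [Finset.sum_congr rfl hJ, Finset.sum_comm, ← hg.sum_eq htU h1]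
    refine Finset.sum_congr rfl fun i _ => ?_
    rw [Finset.sum_ite_eq', if_pos (he i), ← h3 htU i, hg.toC_sphereVal htU h1 hqt]
    obtain ⟨z, -, hz⟩ := hg.exists_mem_fiber htU h1 i
    rw [hz, toC_coe]
  rw [hγ.IFun_eq hPγ (reg_of_notMem_poles hγq) h1 hqt hPt, hmain,
    Finset.sum_congr (s₁ := finitePoles q) rfl fun a ha => by rw [hg.psi_eq htU h1 (hne a ha)]]
  congr 1
  simp only [Finset.mul_sum]
  rw [Finset.sum_comm, ← Finset.sum_sub_distrib]
  refine Finset.sum_congr rfl fun w _ => ?_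
  rw [mul_sub, Finset.mul_sum]
  congr 1
  · ring
  · exact Finset.sum_congr rfl fun a _ => by ring

end

end MomentGen

/-! ### Assembly of the theorem -/

theorem theorem2p1 (P q : RatFunc ℂ) (hP : 0 < MomentGen.degree P) (hq : q ≠ 0)
    (γ : ℝ → ℂ) (hγ : MomentGen.IsClosedCurve γ)
    (hγP : ∀ s ∈ Icc (0 : ℝ) 1, (γ s : OnePoint ℂ) ∉ MomentGen.poles P)
    (hγq : ∀ s ∈ Icc (0 : ℝ) 1, (γ s : OnePoint ℂ) ∉ MomentGen.poles q) :
    -- the formula, for every simply connected domain and every numbering of the branches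
    (∀ U : Set ℂ, IsOpen U → IsSimplyConnected U →
      (∀ t ∈ U, (t : OnePoint ℂ) ∉ MomentGen.branchPoints P) →
      (∞ : OnePoint ℂ) ∈ frontier ((fun t : ℂ => (t : OnePoint ℂ)) '' U) →
      ∀ g : Fin (MomentGen.degree P) → ℂ → OnePoint ℂ, MomentGen.IsBranches P U g →
        -- the functions `ψ_z` are rational
        (∀ z ∈ MomentGen.finitePoles q, ∃ R : RatFunc ℂ, ∀ t ∈ U,
          (∀ i, MomentGen.sphereVal
            (MomentGen.principalPart q z / MomentGen.ratDeriv P) (g i t) ≠ ∞) →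
          MomentGen.sphereVal R t = (MomentGen.psi P q g z t : OnePoint ℂ)) ∧
        -- if `U` has only one end at infinity, then the sets `J_e` partition the branches
        ((∃ᶠ R : ℝ in atTop, IsConnected (U ∩ {t | R < ‖t‖})) →
          ∀ i, ∃! e, e ∈ MomentGen.polesFinset P ∧ i ∈ MomentGen.branchesNear U g e) ∧
        -- the formula holds near infinity whenever the sets `J_e` exhaust the branches
        ((∀ i, ∃ e ∈ MomentGen.polesFinset P, i ∈ MomentGen.branchesNear U g e) →
          ∃ R₀ : ℝ, ∀ t ∈ U, (t : OnePoint ℂ) ∈ MomentGen.UInf P γ → R₀ < ‖t‖ →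
            -- all the terms are finite
            (∀ i, g i t ≠ ∞ ∧
              MomentGen.sphereVal (q / MomentGen.ratDeriv P) (g i t) ≠ ∞ ∧
              ∀ z ∈ MomentGen.finitePoles q, MomentGen.sphereVal
                (MomentGen.principalPart q z / MomentGen.ratDeriv P) (g i t) ≠ ∞) ∧
            MomentGen.sphereVal P ∞ ≠ (t : OnePoint ℂ) ∧
            MomentGen.IFun q P γ t =
              ∑ e ∈ MomentGen.polesFinset P, MomentGen.winding γ e *
                  MomentGen.branchSum P q g (MomentGen.branchesNear U g e) t
                - ∑ z ∈ MomentGen.finitePoles q,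
                    MomentGen.winding γ (z : OnePoint ℂ) * MomentGen.psi P q g z t
                + (2 * Real.pi * Complex.I)⁻¹ * MomentGen.recipAtInfty P t *
                    MomentGen.curveInt γ (MomentGen.val q))) ∧
    -- rationality
    (MomentGen.OnOneSide γ (MomentGen.poles P) →
      ∃ R : RatFunc ℂ, ∀ x ∈ MomentGen.UInf P γ,
        MomentGen.sphereVal R x = (MomentGen.IFun q P γ x : OnePoint ℂ)) ∧
    -- vanishing
    (MomentGen.LieOutside γ (MomentGen.poles P ∪ MomentGen.poles q) →
      ∀ x ∈ MomentGen.UInf P γ, MomentGen.IFun q P γ x = 0) := by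
  refine ⟨fun U hU _ _ hinf g hg => ?_, hγ.exists_ratFunc_eq_IFun hP hγP hγq,
    hγ.IFun_eq_zero hP hγP hγq⟩
  have hbot := MomentGen.neBot_cobounded_inf_principal (frontier_subset_closure hinf)
  refine ⟨fun z _ => hg.exists_ratFunc_eq_psi hP hU q z, fun hconn i => ?_, fun hends => ?_⟩
  · obtain ⟨e, he, hlim⟩ := hg.exists_tendsto hconn i
    exact ⟨e, ⟨MomentGen.mem_polesFinset.2 he, MomentGen.mem_branchesNear.2 hlim⟩,
      fun e' he' => tendsto_nhds_unique (MomentGen.mem_branchesNear.1 he'.2) hlim⟩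
  · have h := hg.eventually_IFun_eq hP hγ hγP hγq hends
    rw [← comap_norm_atTop, eventually_comap] at h
    obtain ⟨R₀, hR₀⟩ := eventually_atTop.1 h
    exact ⟨R₀, fun t htU htinf ht => hR₀ _ ht.le t rfl htU htinf⟩
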